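/- Let $p\ge 1$ be an integer and let $\widehat\Omega=(0,1)^2$. A $p$-open knot vector over $(0,1)$ is a finite nondecreasing sequence of knots in $[0,1]$ in which $0$ and $1$ have multiplicity exactly $p+1$ and every other knot has multiplicity at most $p$; its distinct knots are its breakpoints. Let $S[p,\Xi]$ denote the span of the B-splines of degree $p$ over $\Xi$ (Cox--de Boor formula, with the values at the right end point $1$ defined by continuity). Let $\Xi_1,\Xi_2$ be two $p$-open knot vectors over $(0,1)$ which are quasi-uniform with grid size $0<\widehat h\le 1$ and constant $C_3>0$, i.e. any two consecutive breakpoints $\zeta_i<\zeta_{i+1}$ of either knot vector satisfy $C_3\widehat h\le \zeta_{i+1}-\zeta_i\le \widehat h$. Let $H>0$ and let $G:\widehat\Omega\to\mathbb R^2$ be an injective $W^{1,\infty}$ map (i.e. Lipschitz) whose image $\Omega_G:=G(\widehat\Omega)$ (the physical patch) is open and which satisfies, for a constant $C_1>0$, \[ \|\nabla G\|_{L_\infty(\widehat\Omega)}\le C_1H\quad\text{and}\quad \|(\nabla G)^{-1}\|_{L_\infty(\widehat\Omega)}\le C_1\frac1H . \] Put $h:=\widehat h\,H$ and $\Lambda:=1+\log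 p+\log\frac Hh$. Let $\Gamma\subseteq\partial\widehat\Omega$ be any set (possibly empty; the part of the boundary with Dirichlet conditions), and let \[ \widehat V:=\{v\in S[p,\Xi_1]\otimes S[p,\Xi_2] : v|_{\Gamma}=0\},\qquad V:=\{v\circ G^{-1} : v\in\widehat V\}, \] the latter being a space of functions on $\Omega_G$. Then there is a constant $c>0$ depending only on $C_1$ and $C_3$ (in particular not on $p$, $\Xi_1,\Xi_2$, $\widehat h$, $H$, $\Gamma$, $G$) such that \[ \sup_{x\in\overline{\widehat\Omega}}|\widehat u(x)|^2\le c\,\Lambda\,\|\widehat u\|_{H^1(\widehat\Omega)}^2 \qquad\text{for all }\widehat u\in\widehat V \] and \[ \sup_{x\in\Omega_G}|u(x)|^2\le c\,\Lambda\Big(|u|_{H^1(\Omega_G)}^2+H^{-2}\|u\|_{L_2(\Omega_G)}^2\Big) \qquad\text{for all }u\in V , \] and, whenever $u$ is extended continuously to $\overline{\Omega_G}$, the second estimate also holds with the supremum taken over $\overline{\Omega_G}$. Here $|\cdot|_{H^1}$ is the $L_2$ norm of the weak gradient, $\|\cdot\|_{H^1}^2=\|\cdot\|_{L_2}^2+|\cdot|_{H^1}^2$,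 and a function without a weak gradient has $|\cdot|_{H^1}=\infty$. -/

import Mathlib

open MeasureTheory Set
open scoped ENNReal NNReal ContDiff

namespace SplinePatch

/-- The Euclidean plane. -/
abbrev Plane : Type := EuclideanSpace ℝ (Fin 2)

/-- The parameter domain `(0,1)²`. -/
def unitSquare : Set Plane := {x | ∀ i, x i ∈ Ioo (0 : ℝ) 1}

/-! ### Lebesgue and Sobolev (semi)norms on a domain of the plane -/

/-- `g` is a weak gradient of `u` on the open set `U`. -/
def IsWeakGradient (U : Set Plane) (u : Plane → ℝ) (g : Plane → Plane) : Prop :=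
  LocallyIntegrableOn u U ∧ LocallyIntegrableOn g U ∧
    ∀ φ : Plane → ℝ, ContDiff ℝ ∞ φ → HasCompactSupport φ → tsupport φ ⊆ U →
      ∀ i : Fin 2,
        ∫ x in U, u x * fderiv ℝ φ x (EuclideanSpace.single i 1) = -∫ x in U, g x i * φ x

/-- `‖u‖²` in `L²(U)`, with values in `[0,∞]`. -/
noncomputable def l2NormSq (U : Set Plane) (u : Plane → ℝ) : ℝ≥0∞ :=
  ∫⁻ x in U, ‖u x‖ₑ ^ 2

/-- `|u|²` in `H¹(U)`, with values in `[0,∞]`: the integral of `|∇u|²` for the weak gradient `∇u`,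
which is unique almost everywhere if it exists; the value is `∞` if there is no weak gradient. -/
noncomputable def h1SeminormSq (U : Set Plane) (u : Plane → ℝ) : ℝ≥0∞ :=
  ⨅ (g : Plane → Plane) (_ : IsWeakGradient U u g), ∫⁻ x in U, ‖g x‖ₑ ^ 2

/-- `‖u‖²` in `H¹(U)`. -/
noncomputable def h1NormSq (U : Set Plane) (u : Plane → ℝ) : ℝ≥0∞ :=
  l2NormSq U u + h1SeminormSq U u

/-- The supremum of `|u|²` over `S`. -/
noncomputable def supSq (S : Set Plane) (u : Plane → ℝ) : ℝ≥0∞ :=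
  ⨆ x ∈ S, ‖u x‖ₑ ^ 2

/-! ### Splines -/

/-- A `p`-open knot vector over `(0,1)`, the knots being `knot 0 ≤ ⋯ ≤ knot (n + p)`:
both endpoints have multiplicity exactly `p + 1` and every knot in `(0,1)` has multiplicity at
most `p`. The sequence is continued by `1` beyond the index `n + p`; those further terms do not
enter the B-splines of index `i < n` and degree `p`. -/
structure OpenKnotVector (p : ℕ) where
  /-- The number of B-splines. -/
  n : ℕ
  knot : ℕ → ℝ
  monotone : Monotone knot
  knot_eq_zero_iff : ∀ i, knot i = 0 ↔ i ≤ p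
  knot_eq_one_iff : ∀ i, knot i = 1 ↔ n ≤ i
  mult_le : ∀ i, 0 < knot i → knot i < 1 → knot i < knot (i + p)

/-- The B-splines with knots `ξ` on `[0,1]` by the Cox–de Boor recursion (with `0/0 = 0`).
The last non-empty knot span is closed on the right, so that the B-splines have the correct
values at the right end point `1`. -/
noncomputable def bspline (ξ : ℕ → ℝ) : ℕ → ℕ → ℝ → ℝ
  | 0, i, x =>
    open Classical in
    if (ξ i ≤ x ∧ x < ξ (i + 1)) ∨ (ξ i < ξ (i + 1) ∧ ξ (i + 1) = 1 ∧ x = 1) then 1 else 0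
  | q + 1, i, x =>
    (x - ξ i) / (ξ (i + (q + 1)) - ξ i) * bspline ξ q i x +
      (ξ (i + 1 + (q + 1)) - x) / (ξ (i + 1 + (q + 1)) - ξ (i + 1)) * bspline ξ q (i + 1) x

/-- The spline space `S[p,Ξ]`, the span of the B-splines of degree `p`. -/
noncomputable def splineSpace {p : ℕ} (Ξ : OpenKnotVector p) : Submodule ℝ (ℝ → ℝ) :=
  Submodule.span ℝ (range fun i : Fin Ξ.n => bspline Ξ.knot p i)

/-- The tensor-product spline space `S[p,Ξ₁] ⊗ S[p,Ξ₂]` as a space of functions of two variables. -/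
noncomputable def tensorSplineSpace {p : ℕ} (Ξ₁ Ξ₂ : OpenKnotVector p) :
    Submodule ℝ (Plane → ℝ) :=
  Submodule.span ℝ
    {w | ∃ f ∈ splineSpace Ξ₁, ∃ g ∈ splineSpace Ξ₂, w = fun x => f (x 0) * g (x 1)}

/-- The spline space on the parameter domain: tensor-product splines vanishing on `Γ`. -/
def parameterSpace {p : ℕ} (Ξ₁ Ξ₂ : OpenKnotVector p) (Γ : Set Plane) : Set (Plane → ℝ) :=
  {v | v ∈ tensorSplineSpace Ξ₁ Ξ₂ ∧ ∀ x ∈ Γ, v x = 0}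

/-- The spline space on the physical patch `G '' unitSquare`: functions `u` on the patch with
`u = v ∘ G⁻¹` for some `v` of the spline space on the parameter domain. The values of `u` outside
the patch are arbitrary. -/
def physicalSpace {p : ℕ} (Ξ₁ Ξ₂ : OpenKnotVector p) (Γ : Set Plane) (G : Plane → Plane) :
    Set (Plane → ℝ) :=
  {u | ∃ v ∈ parameterSpace Ξ₁ Ξ₂ Γ, ∀ x ∈ unitSquare, u (G x) = v x}

/-- All knot spans of positive length have length between `C * h` and `h`. -/
def QuasiUniform {p : ℕ} (Ξ : OpenKnotVector p) (C h : ℝ) : Prop :=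
  ∀ i, Ξ.knot i < Ξ.knot (i + 1) →
    C * h ≤ Ξ.knot (i + 1) - Ξ.knot i ∧ Ξ.knot (i + 1) - Ξ.knot i ≤ h

/-! ### Geometry mappings -/

/-- `G` parameterizes an open patch of size `H` by the unit square: it is injective, of class
`W^{1,∞}` (that is, Lipschitz, the square being convex; in particular it extends continuously to
the closed square), and `‖∇G‖ ≤ C * H`, `‖(∇G)⁻¹‖ ≤ C / H` almost everywhere. -/
structure IsGeometryMap (G : Plane → Plane) (C H : ℝ) : Prop where
  injOn : InjOn G unitSquare
  isOpen_image : IsOpen (G '' unitSquare)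
  lipschitz : ∃ L : ℝ≥0, LipschitzOnWith L G unitSquare
  fderiv_bound : ∀ᵐ x ∂(volume.restrict unitSquare), ∃ A : Plane ≃L[ℝ] Plane,
    HasFDerivAt G (A : Plane →L[ℝ] Plane) x ∧
      ‖(A : Plane →L[ℝ] Plane)‖ ≤ C * H ∧ ‖(A.symm : Plane →L[ℝ] Plane)‖ ≤ C / H

/-- The logarithmic factor `Λ = 1 + log p + log (H / h)`. -/
noncomputable def logFactor (p : ℕ) (H h : ℝ) : ℝ :=
  1 + Real.log p + Real.log (H / h)

end SplinePatch

/-! In two dimensions `H¹` just fails to control the supremum, and the failure is logarithmic: the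
mean square of `u` on a segment of length about `s` is at most about `1 + log (1/s)` times the
squared `H¹` norm. For splines, the segment average can be turned into a point value at a scale `s`
that is polynomial in `p` and `1/ĥ`.

Parameter domain. A point of the closed square lies in a cell on which the spline is a polynomial
`F` of degree at most `p` in each variable. Let `M` be the maximum of `|F|` on the closed cell. By
Markov's inequality `|F| ≥ M/2` on a box of half side `s = C ĥ / (48 p²)` inside the cell and near
the maximizer (`IsBipolynomial.abs_sub_le`, `exists_center`). The box is then fed into a logarithmic
Sobolev inequality (`IsWeakGradient.ofReal_sq_le`). Its heart is one-dimensional: along a ray `t ↦ a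
+ t d`, Cauchy-Schwarz with weights `t` and `1/t` costs the factor `∫ dt/t = log (1/s)`
(`sq_le_log_mul_integral`), and the weight `t` is the polar area element once the rays sweep a
triangle (`lintegral_rays_le`). Only a weak gradient is assumed, so the inequality is proved for
mollifications and passed to the limit by Fatou's lemma. Finally `log (p²/ĥ)` is at most a constant
times `Λ` (`one_add_log_le`).

Physical patch. If `u ∘ G = v` on the square, then `‖v‖²` in `H¹` is at most a constant times the
scaled norm of `u`: the bound on `(∇G)⁻¹` controls the Jacobian from below, the bound on `∇G`
controls the chain rule, and in dimension two the powers of `H` cancel in the gradient term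
(`IsGeometryMap.h1NormSq_comp_le`). The weak chain rule for Lipschitz `G` follows by smooth
approximation of `u`. The closure is reached by continuity. -/

namespace SplinePatch

/-! ### Markov's inequality for polynomials -/

/-- Markov's inequality at the right end point of `[-1,1]`. -/
theorem abs_derivative_eval_one_le {p : ℕ} {P : Polynomial ℝ} (hP : P.natDegree ≤ p) {M : ℝ}
    (hM : 0 < M) (h : ∀ x ∈ Icc (-1 : ℝ) 1, |P.eval x| ≤ M) :
    |P.derivative.eval 1| ≤ (p : ℝ) ^ 2 * M := by
  -- The Chebyshev extremality bound is one-sided, so it is applied to both `P / M` and `-P / M`;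
  -- the value `p²` is `T_p'(1)`.
  have key : ∀ c : ℝ, |c| = M⁻¹ → c * P.derivative.eval 1 ≤ (p : ℝ) ^ 2 := by
    intro c hc
    have h1 := Polynomial.Chebyshev.eval_iterate_derivative_le_of_forall_abs_le_one (n := p)
      (P := Polynomial.C c * P) (k := 1) (x := 1) le_rfl
      (Polynomial.degree_le_of_natDegree_le ((Polynomial.natDegree_C_mul_le _ _).trans hP))
      (fun x hx => by
        rw [Polynomial.eval_C_mul, abs_mul, hc, inv_mul_le_iff₀ hM]
        simpa using h x hx)
    have h2 := Polynomial.Chebyshev.derivative_T_eval_one (R := ℝ) p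
    simp only [Function.iterate_one, Polynomial.derivative_C_mul, Polynomial.eval_C_mul] at h1
    rw [h2] at h1
    simpa using h1
  have h1 := key M⁻¹ (abs_of_pos (inv_pos.2 hM))
  have h2 := key (-M⁻¹) (by rw [abs_neg, abs_of_pos (inv_pos.2 hM)])
  have h3 : M⁻¹ * |P.derivative.eval 1| ≤ (p : ℝ) ^ 2 := by
    rcases abs_cases (P.derivative.eval 1) with h | h <;> rw [h.1] <;> linarith
  rwa [inv_mul_le_iff₀ hM, mul_comm] at h3

/-- Markov's inequality at an end point of a segment. -/
theorem abs_derivative_eval_endpoint_le {p : ℕ} {P : Polynomial ℝ} (hP : P.natDegree ≤ p)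
    {M c d : ℝ} (hM : 0 < M) (hcd : c ≠ d) (h : ∀ x ∈ uIcc c d, |P.eval x| ≤ M) :
    |P.derivative.eval d| ≤ 2 * (p : ℝ) ^ 2 * M / |d - c| := by
  have hdc : 0 < |d - c| := abs_pos.2 (sub_ne_zero.2 hcd.symm)
  set ℓ : Polynomial ℝ := Polynomial.C ((d - c) / 2) * Polynomial.X + Polynomial.C ((c + d) / 2)
  have hℓ : ∀ x, ℓ.eval x = (d - c) / 2 * x + (c + d) / 2 := fun x => by simp [ℓ]
  have h1 := abs_derivative_eval_one_le (p := p) (P := P.comp ℓ) (M := M)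
    ((Polynomial.natDegree_comp_le).trans (by
      have : ℓ.natDegree ≤ 1 := Polynomial.natDegree_linear_le
      nlinarith)) hM (fun x hx => by
        rw [Polynomial.eval_comp, hℓ]
        apply h
        rw [mem_uIcc]
        rcases le_total c d with hh | hh
        · left; constructor <;> nlinarith [hx.1, hx.2]
        · right; constructor <;> nlinarith [hx.1, hx.2])
  have h2 : (P.comp ℓ).derivative.eval 1 = (d - c) / 2 * P.derivative.eval d := by
    rw [Polynomial.derivative_comp, Polynomial.eval_mul, Polynomial.eval_comp, hℓ]
    have : (d - c) / 2 * 1 + (c + d) / 2 = d := by ring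
    rw [this]
    simp [ℓ]
  rw [h2, abs_mul, abs_div, abs_two] at h1
  rw [le_div_iff₀ hdc]
  linarith

/-- Markov's inequality on a segment. -/
theorem abs_derivative_eval_le {p : ℕ} {P : Polynomial ℝ} (hP : P.natDegree ≤ p)
    {M a b : ℝ} (hM : 0 < M) (hab : a < b) (h : ∀ x ∈ Icc a b, |P.eval x| ≤ M)
    {x : ℝ} (hx : x ∈ Icc a b) :
    |P.derivative.eval x| ≤ 4 * (p : ℝ) ^ 2 * M / (b - a) := by
  -- Every point `x` is an end point of a segment inside `[a, b]` of at least half the length,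
  -- ending at the farther of `a` and `b`. The end point case thus covers interior points, at the
  -- price of a factor 2.
  obtain ⟨c, hc, hcx⟩ : ∃ c ∈ Icc a b, (b - a) / 2 ≤ |x - c| := by
    rcases le_total x ((a + b) / 2) with hh | hh
    · exact ⟨b, right_mem_Icc.2 hab.le, by rw [abs_sub_comm]; exact le_trans (by linarith) (le_abs_self _)⟩
    · exact ⟨a, left_mem_Icc.2 hab.le, le_trans (by linarith) (le_abs_self _)⟩
  have hpos : 0 < |x - c| := lt_of_lt_of_le (by linarith) hcx
  have h1 := abs_derivative_eval_endpoint_le hP hM (c := c) (d := x)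
    (fun e => by simp [e] at hpos) (fun y hy => h y (uIcc_subset_Icc hc hx hy))
  refine h1.trans ?_
  rw [div_le_div_iff₀ hpos (by linarith)]
  have : 0 ≤ 2 * (p : ℝ) ^ 2 * M := by positivity
  nlinarith

/-- Polynomials of degree at most `p` are Lipschitz with the constant of Markov's inequality. -/
theorem abs_eval_sub_eval_le {p : ℕ} {P : Polynomial ℝ} (hP : P.natDegree ≤ p)
    {M a b : ℝ} (hM : 0 < M) (hab : a < b) (h : ∀ x ∈ Icc a b, |P.eval x| ≤ M)
    {x y : ℝ} (hx : x ∈ Icc a b) (hy : y ∈ Icc a b) :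
    |P.eval y - P.eval x| ≤ 4 * (p : ℝ) ^ 2 * M / (b - a) * |y - x| :=
  (convex_Icc a b).norm_image_sub_le_of_norm_deriv_le (f := fun x => P.eval x)
    (fun z _ => P.differentiableAt)
    (fun z hz => by rw [Polynomial.deriv]; exact abs_derivative_eval_le hP hM hab h hz) hx hy

/-! ### Piecewise polynomial structure of splines -/

/-- The knot span with left end point `ξ j`, closed on the right if it ends at `1`. -/
def knotSpan (ξ : ℕ → ℝ) (j : ℕ) : Set ℝ :=
  {x | (ξ j ≤ x ∧ x < ξ (j + 1)) ∨ (ξ j < ξ (j + 1) ∧ ξ (j + 1) = 1 ∧ x = 1)}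

/-- On every knot span a B-spline of degree `q` is a polynomial of degree at most `q`. -/
theorem exists_polynomial_bspline {ξ : ℕ → ℝ} (hξ : Monotone ξ) (h1 : ∀ i, ξ i ≤ 1) (j q i : ℕ) :
    ∃ P : Polynomial ℝ, P.natDegree ≤ q ∧ ∀ x ∈ knotSpan ξ j, bspline ξ q i x = P.eval x := by
  induction q generalizing i with
  | zero =>
    by_cases hij : i = j
    · subst hij
      refine ⟨1, by simp, fun x hx => ?_⟩
      simp only [knotSpan, mem_ofPred_eq] at hx
      rw [bspline, if_pos hx]; simp
    -- Different spans are disjoint, also at the point 1: by monotonicity only one nonempty span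
    -- ends there.
    · refine ⟨0, by simp, fun x hx => ?_⟩
      rw [bspline, if_neg]
      · simp
      · rintro hi
        rcases lt_or_gt_of_ne hij with h | h
        · have := hξ (show i + 1 ≤ j by omega)
          rcases hx with hx | hx <;> rcases hi with hi | hi <;> linarith [h1 (j + 1), h1 (i + 1)]
        · have := hξ (show j + 1 ≤ i by omega)
          rcases hx with hx | hx <;> rcases hi with hi | hi <;> linarith [h1 (j + 1), h1 (i + 1)]
  | succ q ih =>
    obtain ⟨P, hP, hP'⟩ := ih i
    obtain ⟨R, hR, hR'⟩ := ih (i + 1)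
    refine ⟨Polynomial.C (ξ (i + (q + 1)) - ξ i)⁻¹ * (Polynomial.X - Polynomial.C (ξ i)) * P +
      Polynomial.C (ξ (i + 1 + (q + 1)) - ξ (i + 1))⁻¹ *
        (Polynomial.C (ξ (i + 1 + (q + 1))) - Polynomial.X) * R, ?_, fun x hx => ?_⟩
    · compute_degree!
      omega
    · rw [bspline, hP' x hx, hR' x hx]
      simp [div_eq_inv_mul]

namespace OpenKnotVector

variable {p : ℕ} (Ξ : OpenKnotVector p)

theorem lt_n : p < Ξ.n := by
  by_contra h
  have h0 := (Ξ.knot_eq_zero_iff Ξ.n).2 (not_lt.1 h)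
  have h1 := (Ξ.knot_eq_one_iff Ξ.n).2 le_rfl
  linarith

theorem knot_le_one (i : ℕ) : Ξ.knot i ≤ 1 := by
  rw [← (Ξ.knot_eq_one_iff (max i Ξ.n)).2 (le_max_right _ _)]
  exact Ξ.monotone (le_max_left _ _)

theorem knot_nonneg (i : ℕ) : 0 ≤ Ξ.knot i := by
  rw [← (Ξ.knot_eq_zero_iff 0).2 (Nat.zero_le _)]
  exact Ξ.monotone (Nat.zero_le _)

/-- The knot spans cover the unit interval. -/
theorem exists_mem_knotSpan {x : ℝ} (hx : x ∈ Icc (0 : ℝ) 1) :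
    ∃ j, Ξ.knot j < Ξ.knot (j + 1) ∧ x ∈ knotSpan Ξ.knot j := by
  rcases hx.2.lt_or_eq with h | rfl
  · have hex : ∃ k, x < Ξ.knot k := ⟨Ξ.n, by rwa [(Ξ.knot_eq_one_iff _).2 le_rfl]⟩
    classical
    have h0 : Nat.find hex ≠ 0 := fun h0 => by
      have := Nat.find_spec hex
      rw [h0, (Ξ.knot_eq_zero_iff 0).2 (Nat.zero_le _)] at this
      linarith [hx.1]
    obtain ⟨j, hj⟩ := Nat.exists_eq_succ_of_ne_zero h0
    have h1 : x < Ξ.knot (j + 1) := by have := Nat.find_spec hex; rwa [hj] at this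
    have h2 : Ξ.knot j ≤ x := not_lt.1 (Nat.find_min hex (by omega))
    exact ⟨j, h2.trans_lt h1, Or.inl ⟨h2, h1⟩⟩
  · have hn := Ξ.lt_n
    have h1 : Ξ.knot (Ξ.n - 1 + 1) = 1 := (Ξ.knot_eq_one_iff _).2 (by omega)
    have h2 : Ξ.knot (Ξ.n - 1) ≠ 1 := fun h => by
      have := (Ξ.knot_eq_one_iff _).1 h
      omega
    have h3 := lt_of_le_of_ne (Ξ.knot_le_one _) h2
    exact ⟨Ξ.n - 1, by rwa [h1], Or.inr ⟨by rwa [h1], h1, rfl⟩⟩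

/-- On every knot span a spline is a polynomial. -/
theorem exists_polynomial_of_mem_splineSpace {f : ℝ → ℝ} (hf : f ∈ splineSpace Ξ) (j : ℕ) :
    ∃ P : Polynomial ℝ, P.natDegree ≤ p ∧ ∀ x ∈ knotSpan Ξ.knot j, f x = P.eval x := by
  induction hf using Submodule.span_induction with
  | mem f hf =>
    obtain ⟨i, rfl⟩ := hf
    exact exists_polynomial_bspline Ξ.monotone Ξ.knot_le_one j p i
  | zero => exact ⟨0, by simp, by simp⟩
  | add f g _ _ hf hg =>
    obtain ⟨P, hP, hP'⟩ := hf
    obtain ⟨R, hR, hR'⟩ := hg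
    exact ⟨P + R, (Polynomial.natDegree_add_le _ _).trans (max_le hP hR),
      fun x hx => by simp [hP' x hx, hR' x hx]⟩
  | smul c f _ hf =>
    obtain ⟨P, hP, hP'⟩ := hf
    exact ⟨Polynomial.C c * P, (Polynomial.natDegree_C_mul_le _ _).trans hP,
      fun x hx => by simp [hP' x hx]⟩

end OpenKnotVector

/-- `F` is a polynomial function of degree at most `p` in each of its two variables. -/
structure IsBipolynomial (p : ℕ) (F : ℝ → ℝ → ℝ) : Prop where
  continuous : Continuous fun x : ℝ × ℝ => F x.1 x.2
  left : ∀ y, ∃ P : Polynomial ℝ, P.natDegree ≤ p ∧ ∀ x, F x y = P.eval x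
  right : ∀ x, ∃ P : Polynomial ℝ, P.natDegree ≤ p ∧ ∀ y, F x y = P.eval y

/-- On every product of two knot spans a tensor-product spline is a polynomial. -/
theorem exists_isBipolynomial {p : ℕ} {Ξ₁ Ξ₂ : OpenKnotVector p} {v : Plane → ℝ}
    (hv : v ∈ tensorSplineSpace Ξ₁ Ξ₂) (j k : ℕ) :
    ∃ F, IsBipolynomial p F ∧
      ∀ x : Plane, x 0 ∈ knotSpan Ξ₁.knot j → x 1 ∈ knotSpan Ξ₂.knot k → v x = F (x 0) (x 1) := by
  induction hv using Submodule.span_induction with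
  | mem w hw =>
    obtain ⟨f, hf, g, hg, rfl⟩ := hw
    obtain ⟨P, hP, hP'⟩ := Ξ₁.exists_polynomial_of_mem_splineSpace hf j
    obtain ⟨R, hR, hR'⟩ := Ξ₂.exists_polynomial_of_mem_splineSpace hg k
    refine ⟨fun x y => P.eval x * R.eval y, ⟨?_, fun y => ?_, fun x => ?_⟩, fun x h0 h1 => ?_⟩
    · exact (P.continuous.comp continuous_fst).mul (R.continuous.comp continuous_snd)
    · exact ⟨Polynomial.C (R.eval y) * P, (Polynomial.natDegree_C_mul_le _ _).trans hP,
        fun x => by simp [mul_comm]⟩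
    · exact ⟨Polynomial.C (P.eval x) * R, (Polynomial.natDegree_C_mul_le _ _).trans hR,
        fun x => by simp⟩
    · simp [hP' _ h0, hR' _ h1]
  | zero =>
    exact ⟨fun _ _ => 0, ⟨continuous_const, fun _ => ⟨0, by simp, by simp⟩,
      fun _ => ⟨0, by simp, by simp⟩⟩, by simp⟩
  | add v w _ _ hv hw =>
    obtain ⟨F, hF, hF'⟩ := hv
    obtain ⟨F₂, hF₂, hF₂'⟩ := hw
    refine ⟨fun x y => F x y + F₂ x y, ⟨hF.continuous.add hF₂.continuous, fun y => ?_, fun x => ?_⟩,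
      fun x h0 h1 => by simp [hF' x h0 h1, hF₂' x h0 h1]⟩
    · obtain ⟨P, hP, hP'⟩ := hF.left y
      obtain ⟨R, hR, hR'⟩ := hF₂.left y
      exact ⟨P + R, (Polynomial.natDegree_add_le _ _).trans (max_le hP hR),
        fun x => by simp [hP' x, hR' x]⟩
    · obtain ⟨P, hP, hP'⟩ := hF.right x
      obtain ⟨R, hR, hR'⟩ := hF₂.right x
      exact ⟨P + R, (Polynomial.natDegree_add_le _ _).trans (max_le hP hR),
        fun x => by simp [hP' x, hR' x]⟩
  | smul c v _ hv =>
    obtain ⟨F, hF, hF'⟩ := hv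
    refine ⟨fun x y => c * F x y, ⟨hF.continuous.const_mul c, fun y => ?_, fun x => ?_⟩,
      fun x h0 h1 => by simp [hF' x h0 h1]⟩
    · obtain ⟨P, hP, hP'⟩ := hF.left y
      exact ⟨Polynomial.C c * P, (Polynomial.natDegree_C_mul_le _ _).trans hP,
        fun x => by simp [hP' x]⟩
    · obtain ⟨P, hP, hP'⟩ := hF.right x
      exact ⟨Polynomial.C c * P, (Polynomial.natDegree_C_mul_le _ _).trans hP,
        fun x => by simp [hP' x]⟩

/-- The cells of a tensor-product spline, with the closed unit square being their union. -/
theorem exists_cell {p : ℕ} {Ξ₁ Ξ₂ : OpenKnotVector p} {C h : ℝ} (h₁ : QuasiUniform Ξ₁ C h)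
    (h₂ : QuasiUniform Ξ₂ C h) {v : Plane → ℝ} (hv : v ∈ tensorSplineSpace Ξ₁ Ξ₂) {x : Plane}
    (hx : ∀ i, x i ∈ Icc (0 : ℝ) 1) :
    ∃ (l r : Fin 2 → ℝ) (F : ℝ → ℝ → ℝ), IsBipolynomial p F ∧
      (∀ i, 0 ≤ l i ∧ r i ≤ 1 ∧ l i < r i ∧ C * h ≤ r i - l i ∧ x i ∈ Icc (l i) (r i)) ∧
      v x = F (x 0) (x 1) ∧ ∀ y : Plane, (∀ i, y i ∈ Ioo (l i) (r i)) → v y = F (y 0) (y 1) := by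
  obtain ⟨j, hj, hxj⟩ := Ξ₁.exists_mem_knotSpan (hx 0)
  obtain ⟨k, hk, hxk⟩ := Ξ₂.exists_mem_knotSpan (hx 1)
  obtain ⟨F, hF, hFv⟩ := exists_isBipolynomial hv j k
  have aux : ∀ {ξ : ℕ → ℝ} {j : ℕ} {x : ℝ}, x ∈ knotSpan ξ j → x ∈ Icc (ξ j) (ξ (j + 1)) := by
    rintro ξ j x (h | h)
    · exact ⟨h.1, h.2.le⟩
    · exact ⟨by linarith, by linarith⟩
  refine ⟨![Ξ₁.knot j, Ξ₂.knot k], ![Ξ₁.knot (j + 1), Ξ₂.knot (k + 1)], F, hF, ?_,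
    hFv x hxj hxk, fun y hy => ?_⟩
  · intro i
    fin_cases i
    · exact ⟨Ξ₁.knot_nonneg _, Ξ₁.knot_le_one _, hj, (h₁ j hj).1, aux hxj⟩
    · exact ⟨Ξ₂.knot_nonneg _, Ξ₂.knot_le_one _, hk, (h₂ k hk).1, aux hxk⟩
  · exact hFv y (Or.inl ⟨(hy 0).1.le, (hy 0).2⟩) (Or.inl ⟨(hy 1).1.le, (hy 1).2⟩)

/-! ### The logarithmic inequality on rays and on squares -/

/-- A weighted one-dimensional Sobolev inequality with logarithmic constant. -/
theorem sq_le_log_mul_integral {ψ ψ' : ℝ → ℝ} (hψ : ∀ t, HasDerivAt ψ (ψ' t) t)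
    (hc : Continuous ψ') {s : ℝ} (hs : 0 < s) (hs' : s ≤ 1 / 2) :
    ψ s ^ 2 ≤ 6 * (1 + Real.log (1 / s)) * ∫ t in s..1, t * (ψ t ^ 2 + ψ' t ^ 2) := by
  have hψc : Continuous ψ := continuous_iff_continuousAt.2 fun t => (hψ t).continuousAt
  set L := Real.log (1 / s) with hL
  set A := ∫ t in s..1, t * ψ t ^ 2 with hA
  set E := ∫ t in s..1, t * ψ' t ^ 2 with hE
  have hLpos : 0 < L := Real.log_pos (by rw [lt_div_iff₀ hs]; linarith)
  have cA : Continuous fun t => t * ψ t ^ 2 := by fun_prop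
  have cE : Continuous fun t => t * ψ' t ^ 2 := by fun_prop
  have hA0 : 0 ≤ A := intervalIntegral.integral_nonneg (by linarith) fun t ht => by
    have : 0 ≤ t := hs.le.trans ht.1; positivity
  have hE0 : 0 ≤ E := intervalIntegral.integral_nonneg (by linarith) fun t ht => by
    have : 0 ≤ t := hs.le.trans ht.1; positivity
  have hAE : ∫ t in s..1, t * (ψ t ^ 2 + ψ' t ^ 2) = A + E := by
    rw [hA, hE, ← intervalIntegral.integral_add (cA.intervalIntegrable _ _)
      (cE.intervalIntegrable _ _)]
    simp only [mul_add]
  have diff : ∀ r ∈ Icc (1 / 2 : ℝ) 1, (ψ r - ψ s) ^ 2 ≤ L * E := by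
    intro r hr
    have hsr : s ≤ r := hs'.trans hr.1
    have hr0 : 0 < r := by linarith [hr.1]
    have hmem : (0 : ℝ) ∉ uIcc s r := by
      rw [uIcc_of_le hsr]; exact fun h => by linarith [h.1]
    have hD : ∫ t in s..r, ψ' t = ψ r - ψ s :=
      intervalIntegral.integral_eq_sub_of_hasDerivAt (fun t _ => hψ t) (hc.intervalIntegrable _ _)
    have hlog : ∫ t in s..r, 1 / t = Real.log (r / s) := by
      simpa using integral_inv_of_pos hs hr0
    have hlogL : Real.log (r / s) ≤ L :=
      Real.log_le_log (by positivity) (by gcongr; exact hr.2)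
    have hEr : ∫ t in s..r, t * ψ' t ^ 2 ≤ E := by
      rw [hE, ← intervalIntegral.integral_add_adjacent_intervals (a := s) (b := r) (c := 1)
        (cE.intervalIntegrable _ _) (cE.intervalIntegrable _ _)]
      have : 0 ≤ ∫ t in r..1, t * ψ' t ^ 2 :=
        intervalIntegral.integral_nonneg hr.2 fun t ht => by
          have : 0 ≤ t := by linarith [ht.1]
          positivity
      linarith
    -- Cauchy-Schwarz in the form of a nonnegative quadratic: integrate `(c - t ψ')² / t ≥ 0` over
    -- `[s, r]`, then take the minimizer `c = (ψ r - ψ s) / L`.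
    have quad : ∀ c : ℝ, 0 ≤ c ^ 2 * L - 2 * c * (ψ r - ψ s) + E := by
      intro c
      have i1 : IntervalIntegrable (fun t : ℝ => 1 / t) volume s r :=
        intervalIntegral.intervalIntegrable_one_div (fun t ht h => hmem (h ▸ ht)) continuousOn_id
      have h0 : 0 ≤ ∫ t in s..r, (c ^ 2 * (1 / t) - 2 * c * ψ' t + t * ψ' t ^ 2) :=
        intervalIntegral.integral_nonneg hsr fun t ht => by
          have ht0 : 0 < t := lt_of_lt_of_le hs ht.1
          have : c ^ 2 * (1 / t) - 2 * c * ψ' t + t * ψ' t ^ 2 = (c - t * ψ' t) ^ 2 / t := by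
            field_simp
            ring
          rw [this]; positivity
      rw [intervalIntegral.integral_add
        ((i1.const_mul _).sub ((hc.intervalIntegrable _ _).const_mul _))
        (cE.intervalIntegrable _ _),
        intervalIntegral.integral_sub (i1.const_mul _) ((hc.intervalIntegrable _ _).const_mul _),
        intervalIntegral.integral_const_mul, intervalIntegral.integral_const_mul, hD, hlog] at h0
      nlinarith [mul_le_mul_of_nonneg_left hlogL (sq_nonneg c)]
    have h1 := quad ((ψ r - ψ s) / L)
    have h2 : ((ψ r - ψ s) / L) ^ 2 * L - 2 * ((ψ r - ψ s) / L) * (ψ r - ψ s) + E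
        = E - (ψ r - ψ s) ^ 2 / L := by
      field_simp
      ring
    rw [h2, sub_nonneg, div_le_iff₀ hLpos] at h1
    linarith
  -- Averaging `ψ(s)² ≤ 2 ψ(r)² + 2 L E` over `r ∈ [1/2, 1]` with weight `r`, of mass `3/8`, gives
  -- `ψ(s)² ≤ (16/3) A + 2 L E`, hence the constant 6.
  have hint : ∫ r in (1 / 2 : ℝ)..1, r * ψ s ^ 2 ≤
      ∫ r in (1 / 2 : ℝ)..1, (2 * (r * ψ r ^ 2) + 2 * (L * E) * r) := by
    apply intervalIntegral.integral_mono_on (by norm_num)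
      (Continuous.intervalIntegrable (by fun_prop) _ _)
      (Continuous.intervalIntegrable (by fun_prop) _ _)
    intro r hr
    have h1 := diff r hr
    have hr0 : 0 ≤ r := by linarith [hr.1]
    have h2 : ψ s ^ 2 ≤ 2 * ψ r ^ 2 + 2 * (L * E) := by nlinarith [sq_nonneg (2 * ψ r - ψ s)]
    nlinarith [mul_le_mul_of_nonneg_left h2 hr0]
  have hid : ∫ r in (1 / 2 : ℝ)..1, r = 3 / 8 := by rw [integral_id]; norm_num
  have hAr : ∫ r in (1 / 2 : ℝ)..1, r * ψ r ^ 2 ≤ A := by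
    rw [hA, ← intervalIntegral.integral_add_adjacent_intervals (a := s) (b := 1 / 2) (c := 1)
      (cA.intervalIntegrable _ _) (cA.intervalIntegrable _ _)]
    have : 0 ≤ ∫ t in s..(1 / 2), t * ψ t ^ 2 :=
      intervalIntegral.integral_nonneg hs' fun t ht => by
        have : 0 ≤ t := by linarith [ht.1]
        positivity
    linarith
  rw [intervalIntegral.integral_mul_const,
    intervalIntegral.integral_add (Continuous.intervalIntegrable (by fun_prop) _ _)
      (Continuous.intervalIntegrable (by fun_prop) _ _), intervalIntegral.integral_const_mul,
    intervalIntegral.integral_const_mul, hid] at hint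
  rw [hAE]
  nlinarith [mul_nonneg hLpos.le hA0, mul_nonneg hLpos.le hE0]

/-- Affine substitution in one variable. -/
theorem ofReal_abs_mul_lintegral_comp_affine_le {f : ℝ → ℝ≥0∞} (hf : Measurable f) {c d : ℝ}
    (hc : c ≠ 0) {A B : Set ℝ} (hA : MeasurableSet A) (hB : MeasurableSet B)
    (hAB : MapsTo (fun x => c * x + d) A B) :
    ENNReal.ofReal |c| * ∫⁻ x in A, f (c * x + d) ≤ ∫⁻ y in B, f y := by
  have h1 : ∫⁻ x in A, f (c * x + d) ≤ ∫⁻ x, B.indicator f (c * x + d) := by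
    rw [← lintegral_indicator hA]
    refine lintegral_mono fun x => ?_
    by_cases hx : x ∈ A
    · rw [indicator_of_mem hx, indicator_of_mem (hAB hx)]
    · rw [indicator_of_notMem hx]; exact zero_le
  have h2 : ∫⁻ x, B.indicator f (c * x + d) = ENNReal.ofReal |c⁻¹| * ∫⁻ y in B, f y := by
    have hm : Measurable fun y => B.indicator f (y + d) :=
      (hf.indicator hB).comp (measurable_id.add_const d)
    have := lintegral_map (μ := volume) hm (measurable_const_mul c)
    rw [← this, Real.map_volume_mul_left hc, lintegral_smul_measure,
      lintegral_add_right_eq_self (μ := volume) (B.indicator f) d, lintegral_indicator hB,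
      smul_eq_mul]
  calc ENNReal.ofReal |c| * ∫⁻ x in A, f (c * x + d)
      ≤ ENNReal.ofReal |c| * (ENNReal.ofReal |c⁻¹| * ∫⁻ y in B, f y) := by
        gcongr; exact h1.trans h2.le
    _ = ∫⁻ y in B, f y := by
        rw [← mul_assoc, ← ENNReal.ofReal_mul (abs_nonneg _), ← abs_mul, mul_inv_cancel₀ hc]
        simp

/-- Integration over the triangle with vertex `(a,b)` and opposite side `{e} × (α,β)` along the
rays through the vertex. -/
theorem lintegral_rays_le {Φ : ℝ → ℝ → ℝ≥0∞} (hΦ : Measurable (Function.uncurry Φ))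
    {α β a b e : ℝ} (ha : a ∈ Ioo α β) (hb : b ∈ Ioo α β) (he : e ∈ Icc α β) (hae : e ≠ a) :
    ENNReal.ofReal |e - a| * ∫⁻ m in Ioo α β, ∫⁻ t in Ioo (0 : ℝ) 1,
      ENNReal.ofReal t * Φ (a + t * (e - a)) (b + t * (m - b)) ≤
    ∫⁻ x in Ioo α β, ∫⁻ y in Ioo α β, Φ x y := by
  have hmeas : Measurable fun x => ∫⁻ y in Ioo α β, Φ x y :=
    hΦ.lintegral_prod_right'
  have hswap : ∫⁻ m in Ioo α β, ∫⁻ t in Ioo (0 : ℝ) 1,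
        ENNReal.ofReal t * Φ (a + t * (e - a)) (b + t * (m - b)) =
      ∫⁻ t in Ioo (0 : ℝ) 1, ∫⁻ m in Ioo α β,
        ENNReal.ofReal t * Φ (a + t * (e - a)) (b + t * (m - b)) := by
    apply lintegral_lintegral_swap
    apply Measurable.aemeasurable
    have : Measurable fun q : ℝ × ℝ => (a + q.2 * (e - a), b + q.2 * (q.1 - b)) := by fun_prop
    exact (ENNReal.measurable_ofReal.comp measurable_snd).mul (hΦ.comp this)
  -- For fixed `t` the map `m ↦ b + t (m - b)` has slope `t`, which absorbs the weight `t`. The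
  -- remaining substitution `x = a + t (e - a)` absorbs `|e - a|`; together they form the Jacobian
  -- of the ray coordinates.
  have hinner : ∫⁻ t in Ioo (0 : ℝ) 1, ∫⁻ m in Ioo α β,
        ENNReal.ofReal t * Φ (a + t * (e - a)) (b + t * (m - b)) ≤
      ∫⁻ t in Ioo (0 : ℝ) 1, ∫⁻ y in Ioo α β, Φ ((e - a) * t + a) y := by
    refine setLIntegral_mono' measurableSet_Ioo fun t ht => ?_
    rw [lintegral_const_mul' _ _ ENNReal.ofReal_ne_top]
    have h := ofReal_abs_mul_lintegral_comp_affine_le (f := fun y => Φ ((e - a) * t + a) y)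
      (hΦ.comp (measurable_const.prodMk measurable_id)) (c := t) (d := b - t * b) ht.1.ne'
      (A := Ioo α β) (B := Ioo α β) measurableSet_Ioo measurableSet_Ioo (fun m hm => by
        constructor <;> nlinarith [ht.1, ht.2, hm.1, hm.2, hb.1, hb.2])
    rw [abs_of_pos ht.1] at h
    refine le_trans (le_of_eq ?_) h
    congr 1
    refine lintegral_congr fun m => ?_
    congr 1 <;> ring
  rw [hswap]
  refine (mul_le_mul_right hinner _).trans ?_
  exact ofReal_abs_mul_lintegral_comp_affine_le hmeas (sub_ne_zero.2 hae) measurableSet_Ioo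
    measurableSet_Ioo (fun t ht => by
      constructor <;> nlinarith [ht.1, ht.2, ha.1, ha.2, he.1, he.2])

/-- Integrals over squares as iterated integrals. -/
theorem setLIntegral_square {Φ : Plane → ℝ≥0∞} (hΦ : Measurable Φ) (α β : ℝ) :
    ∫⁻ x in {x : Plane | ∀ i, x i ∈ Ioo α β}, Φ x =
      ∫⁻ x in Ioo α β, ∫⁻ y in Ioo α β, Φ !₂[x, y] := by
  have hmp := ((EuclideanSpace.volume_preserving_symm_measurableEquiv_toLp (Fin 2)).symm _).comp
    ((volume_preserving_finTwoArrow ℝ).symm _)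
  set T : ℝ × ℝ → Plane := _ with hT
  change MeasurePreserving T volume volume at hmp
  have hTe : ∀ q : ℝ × ℝ, T q = !₂[q.1, q.2] := fun q => by
    rfl
  have hS : MeasurableSet {x : Plane | ∀ i, x i ∈ Ioo α β} := by
    have : {x : Plane | ∀ i, x i ∈ Ioo α β} = ⋂ i, (fun x : Plane => x i) ⁻¹' Ioo α β := by
      ext; simp
    rw [this]
    exact MeasurableSet.iInter fun i => measurableSet_Ioo.preimage (by fun_prop)
  rw [← hmp.setLIntegral_comp_preimage hS hΦ]
  have : T ⁻¹' {x : Plane | ∀ i, x i ∈ Ioo α β} = Ioo α β ×ˢ Ioo α β := by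
    ext q
    simp [hTe, Fin.forall_fin_two]
  rw [this, Measure.volume_eq_prod, ← Measure.prod_restrict, lintegral_prod]
  · rfl
  · exact (hΦ.comp hmp.measurable).aemeasurable

/-- The Sobolev inequality with logarithmic constant for smooth functions on a square and a
small segment. -/
theorem lintegral_segment_le {w : Plane → ℝ} (hw : ContDiff ℝ 1 w) {α β a b e s : ℝ}
    (hαβ : β - α ≤ 1) (ha : a ∈ Ioo α β) (hb : b ∈ Ioo α β)
    (he : e ∈ Icc α β) (hae : 1 / 4 ≤ |e - a|) (hs : 0 < s) (hs' : s ≤ 1 / 2) :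
    ∫⁻ m in Ioo α β, ‖w !₂[a + s * (e - a), b + s * (m - b)]‖ₑ ^ 2 ≤
      ENNReal.ofReal (48 * (1 + Real.log (1 / s))) *
      ((∫⁻ x in {x : Plane | ∀ i, x i ∈ Ioo α β}, ‖w x‖ₑ ^ 2) +
        ∫⁻ x in {x : Plane | ∀ i, x i ∈ Ioo α β}, ‖fderiv ℝ w x‖ₑ ^ 2) := by
  set L := Real.log (1 / s)
  have hL : 0 ≤ L := Real.log_nonneg (by rw [le_div_iff₀ hs]; linarith)
  have hcw : Continuous w := hw.continuous
  have hcd : Continuous (fderiv ℝ w) := hw.continuous_fderiv one_ne_zero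
  -- The factor 2 bounds the squared length of the ray direction `d`, whose components are at most 1
  -- in modulus.
  set Φ : Plane → ℝ := fun x => w x ^ 2 + 2 * ‖fderiv ℝ w x‖ ^ 2
  have hΦc : Continuous Φ := by fun_prop
  have hΦ0 : ∀ x, 0 ≤ Φ x := fun x => by positivity
  set Q := {x : Plane | ∀ i, x i ∈ Ioo α β}
  have ray : ∀ m ∈ Ioo α β, ‖w !₂[a + s * (e - a), b + s * (m - b)]‖ₑ ^ 2 ≤
      ENNReal.ofReal (6 * (1 + L)) * ∫⁻ t in Ioo (0 : ℝ) 1,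
        ENNReal.ofReal t * ENNReal.ofReal (Φ !₂[a + t * (e - a), b + t * (m - b)]) := by
    intro m hm
    set d : Plane := !₂[e - a, m - b]
    set z : ℝ → Plane := fun t => !₂[a, b] + t • d with hz
    have hzt : ∀ t, z t = !₂[a + t * (e - a), b + t * (m - b)] := fun t => by
      ext i; fin_cases i <;> simp [hz, d]
    have hzd : ∀ t, HasDerivAt z d t := fun t => by
      simpa [hz] using! ((hasDerivAt_id t).smul_const d).const_add !₂[a, b]
    have hd : ‖d‖ ^ 2 ≤ 2 := by
      rw [EuclideanSpace.norm_sq_eq]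
      simp only [Fin.sum_univ_two, d, Real.norm_eq_abs, sq_abs]
      simp
      nlinarith [ha.1, ha.2, hb.1, hb.2, he.1, he.2, hm.1, hm.2]
    have hψ : ∀ t, HasDerivAt (fun t => w (z t)) (fderiv ℝ w (z t) d) t := fun t =>
      ((hw.differentiable one_ne_zero) (z t)).hasFDerivAt.comp_hasDerivAt t (hzd t)
    have hzc : Continuous z := by fun_prop
    have h1 := sq_le_log_mul_integral hψ (by fun_prop) hs hs'
    have hmono : ∫ t in s..1, t * (w (z t) ^ 2 + (fderiv ℝ w (z t) d) ^ 2) ≤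
        ∫ t in s..1, t * Φ (z t) := by
      apply intervalIntegral.integral_mono_on (by linarith)
        (Continuous.intervalIntegrable (by fun_prop) _ _)
        (Continuous.intervalIntegrable (by fun_prop) _ _)
      intro t ht
      have h2 : (fderiv ℝ w (z t) d) ^ 2 ≤ 2 * ‖fderiv ℝ w (z t)‖ ^ 2 := by
        have := (fderiv ℝ w (z t)).le_opNorm d
        rw [← sq_abs, ← Real.norm_eq_abs]
        calc ‖fderiv ℝ w (z t) d‖ ^ 2 ≤ (‖fderiv ℝ w (z t)‖ * ‖d‖) ^ 2 := by gcongr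
          _ = ‖fderiv ℝ w (z t)‖ ^ 2 * ‖d‖ ^ 2 := by ring
          _ ≤ ‖fderiv ℝ w (z t)‖ ^ 2 * 2 := by gcongr
          _ = _ := by ring
      exact mul_le_mul_of_nonneg_left (by simp only [Φ]; linarith) (by linarith [ht.1])
    have h2 : w (z s) ^ 2 ≤ 6 * (1 + L) * ∫ t in s..1, t * Φ (z t) := h1.trans (by gcongr)
    rw [← hzt, ← ofReal_norm, ← ENNReal.ofReal_pow (norm_nonneg _), Real.norm_eq_abs, sq_abs]
    refine (ENNReal.ofReal_le_ofReal h2).trans ?_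
    rw [ENNReal.ofReal_mul (by positivity)]
    gcongr
    rw [intervalIntegral.integral_of_le (by linarith), ofReal_integral_eq_lintegral_ofReal]
    · rw [restrict_Ioo_eq_restrict_Ioc]
      refine le_trans (lintegral_mono_set (Ioc_subset_Ioc_left hs.le)) (le_of_eq ?_)
      refine setLIntegral_congr_fun measurableSet_Ioc fun t ht => ?_
      rw [ENNReal.ofReal_mul ht.1.le, hzt]
    · exact (Continuous.intervalIntegrable (by fun_prop) _ _).1
    · refine (ae_restrict_iff' measurableSet_Ioc).2 (Filter.Eventually.of_forall fun t ht => ?_)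
      exact mul_nonneg (hs.le.trans ht.1.le) (hΦ0 _)
  have hΦm : Measurable fun x => ENNReal.ofReal (Φ x) := hΦc.measurable.ennreal_ofReal
  have hae' : e ≠ a := fun h => by rw [h] at hae; norm_num at hae
  have hfub := lintegral_rays_le (Φ := fun x y => ENNReal.ofReal (Φ !₂[x, y]))
    (by
      have : Continuous fun q : ℝ × ℝ => Φ !₂[q.1, q.2] := by fun_prop
      exact this.measurable.ennreal_ofReal) ha hb he hae'
  rw [← setLIntegral_square hΦm] at hfub
  set I := ∫⁻ m in Ioo α β, ‖w !₂[a + s * (e - a), b + s * (m - b)]‖ₑ ^ 2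
  have hint : I ≤ ENNReal.ofReal (6 * (1 + L)) *
      ∫⁻ m in Ioo α β, ∫⁻ t in Ioo (0 : ℝ) 1,
        ENNReal.ofReal t * ENNReal.ofReal (Φ !₂[a + t * (e - a), b + t * (m - b)]) := by
    rw [← lintegral_const_mul' _ _ ENNReal.ofReal_ne_top]
    exact setLIntegral_mono' measurableSet_Ioo ray
  have hΦle : ∫⁻ x in Q, ENNReal.ofReal (Φ x) ≤
      2 * ((∫⁻ x in Q, ‖w x‖ₑ ^ 2) + ∫⁻ x in Q, ‖fderiv ℝ w x‖ₑ ^ 2) := by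
    rw [← lintegral_add_left (by fun_prop), ← lintegral_const_mul' _ _ (by simp)]
    refine lintegral_mono fun x => ?_
    simp only [Φ]
    rw [ENNReal.ofReal_add (by positivity) (by positivity), ENNReal.ofReal_mul (by positivity),
      ← ofReal_norm, ← ofReal_norm, ← ENNReal.ofReal_pow (norm_nonneg _),
      ← ENNReal.ofReal_pow (norm_nonneg _), mul_add, Real.norm_eq_abs, sq_abs]
    gcongr
    · exact le_mul_of_one_le_left zero_le (by norm_num)
    · simp
  -- The constant is `48 = 6 · 4 · 2`: the one-dimensional inequality, `1 / |e - a| ≤ 4`, and the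
  -- factor 2 in `Φ`.
  calc I ≤ ENNReal.ofReal (4 * |e - a|) * I := by
        refine le_mul_of_one_le_left zero_le ?_
        rw [← ENNReal.ofReal_one]
        exact ENNReal.ofReal_le_ofReal (by linarith)
    _ ≤ ENNReal.ofReal (4 * |e - a|) * (ENNReal.ofReal (6 * (1 + L)) *
      ∫⁻ m in Ioo α β, ∫⁻ t in Ioo (0 : ℝ) 1,
        ENNReal.ofReal t * ENNReal.ofReal (Φ !₂[a + t * (e - a), b + t * (m - b)])) := by gcongr
    _ = ENNReal.ofReal (24 * (1 + L)) * (ENNReal.ofReal |e - a| *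
      ∫⁻ m in Ioo α β, ∫⁻ t in Ioo (0 : ℝ) 1,
        ENNReal.ofReal t * ENNReal.ofReal (Φ !₂[a + t * (e - a), b + t * (m - b)])) := by
        rw [← mul_assoc, ← mul_assoc, ← ENNReal.ofReal_mul (by positivity),
          ← ENNReal.ofReal_mul (by positivity)]
        congr 2
        ring
    _ ≤ ENNReal.ofReal (24 * (1 + L)) *
        (2 * ((∫⁻ x in Q, ‖w x‖ₑ ^ 2) + ∫⁻ x in Q, ‖fderiv ℝ w x‖ₑ ^ 2)) :=
        mul_le_mul_right (hfub.trans hΦle) _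
    _ = _ := by
        rw [← mul_assoc]
        congr 1
        rw [show (48 : ℝ) * (1 + L) = 24 * (1 + L) * 2 by ring,
          ENNReal.ofReal_mul (p := 24 * (1 + L)) (by positivity)]
        simp

/-! ### Mollification and weak gradients -/

open scoped Convolution Topology
open ContinuousLinearMap (lsmul lsmul_apply)
open Filter (Tendsto atTop)

section Convolution

variable {E : Type*} [NormedAddCommGroup E] [NormedSpace ℝ E]

/-- Jensen's inequality for mollifications. -/
theorem enorm_convolution_pow_le (φ : ContDiffBump (0 : Plane)) {f : Plane → E}
    (hf : AEStronglyMeasurable f volume) {k : ℕ} (hk : 1 ≤ k) (x : Plane) :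
    ‖(φ.normed volume ⋆[lsmul ℝ ℝ, volume] f) x‖ₑ ^ k ≤
      ∫⁻ t, ENNReal.ofReal (φ.normed volume t) * ‖f (x - t)‖ₑ ^ k := by
  have hφm : Measurable fun t => ENNReal.ofReal (φ.normed volume t) :=
    φ.continuous_normed.measurable.ennreal_ofReal
  -- The mollification at `x` is the mean of `f (x - ·)` for the probability measure `ν`, so
  -- Jensen's inequality is the monotonicity of `L^k(ν)` norms in `k`.
  set ν : Measure Plane := volume.withDensity fun t => ENNReal.ofReal (φ.normed volume t)
  have hν : IsProbabilityMeasure ν := ⟨by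
    rw [withDensity_apply _ MeasurableSet.univ, Measure.restrict_univ,
      ← ofReal_integral_eq_lintegral_ofReal φ.integrable_normed
        (Filter.Eventually.of_forall fun t => φ.nonneg_normed t), φ.integral_normed]
    simp⟩
  have hfx : AEStronglyMeasurable (fun t => f (x - t)) ν :=
    (hf.comp_quasiMeasurePreserving
      (quasiMeasurePreserving_sub_left_of_right_invariant volume x)).mono_ac
      (withDensity_absolutelyContinuous _ _)
  have h1 : ‖(φ.normed volume ⋆[lsmul ℝ ℝ, volume] f) x‖ₑ ≤ eLpNorm (fun t => f (x - t)) 1 ν := by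
    rw [eLpNorm_one_eq_lintegral_enorm, lintegral_withDensity_eq_lintegral_mul₀' hφm.aemeasurable
      hfx.enorm]
    refine (enorm_integral_le_lintegral_enorm _).trans (le_of_eq (lintegral_congr fun t => ?_))
    simp only [lsmul_apply, enorm_smul, Pi.mul_apply]
    rw [Real.enorm_of_nonneg (φ.nonneg_normed t)]
  have h2 : eLpNorm (fun t => f (x - t)) 1 ν ≤ eLpNorm (fun t => f (x - t)) (k : ℝ≥0) ν :=
    eLpNorm_le_eLpNorm_of_exponent_le (by exact_mod_cast hk) hfx
  have hk0 : (k : ℝ≥0) ≠ 0 := by positivity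
  have h3 := eLpNorm_nnreal_pow_eq_lintegral (μ := ν) (f := fun t => f (x - t)) hk0
  simp only [NNReal.coe_natCast, ENNReal.rpow_natCast] at h3
  calc _ ≤ eLpNorm (fun t => f (x - t)) (k : ℝ≥0) ν ^ k := by gcongr; exact h1.trans h2
    _ = _ := by
      rw [h3, lintegral_withDensity_eq_lintegral_mul₀' hφm.aemeasurable (hfx.enorm.pow_const k)]
      rfl

/-- Mollification does not increase Lebesgue norms. -/
theorem lintegral_enorm_convolution_pow_le (φ : ContDiffBump (0 : Plane)) {f : Plane → E}
    (hf : AEStronglyMeasurable f volume) {k : ℕ} (hk : 1 ≤ k) :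
    ∫⁻ x, ‖(φ.normed volume ⋆[lsmul ℝ ℝ, volume] f) x‖ₑ ^ k ≤ ∫⁻ x, ‖f x‖ₑ ^ k := by
  have hφm : Measurable fun t => ENNReal.ofReal (φ.normed volume t) :=
    φ.continuous_normed.measurable.ennreal_ofReal
  calc _ ≤ ∫⁻ x, ∫⁻ t, ENNReal.ofReal (φ.normed volume t) * ‖f (x - t)‖ₑ ^ k :=
        lintegral_mono fun x => enorm_convolution_pow_le φ hf hk x
    _ = ∫⁻ t, ∫⁻ x, ENNReal.ofReal (φ.normed volume t) * ‖f (x - t)‖ₑ ^ k := by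
        apply lintegral_lintegral_swap
        have h1 : AEStronglyMeasurable (fun q : Plane × Plane => f (q.1 - q.2))
            (volume.prod volume) :=
          hf.comp_quasiMeasurePreserving (quasiMeasurePreserving_sub volume volume)
        exact (hφm.comp measurable_snd).aemeasurable.mul (h1.enorm.pow_const k)
    _ = ∫⁻ t, ENNReal.ofReal (φ.normed volume t) * ∫⁻ x, ‖f x‖ₑ ^ k := by
        refine lintegral_congr fun t => ?_
        rw [lintegral_const_mul' _ _ ENNReal.ofReal_ne_top,
          lintegral_sub_right_eq_self (μ := volume) (fun x => ‖f x‖ₑ ^ k) t]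
    _ = _ := by
        rw [lintegral_mul_const _ hφm, ← ofReal_integral_eq_lintegral_ofReal φ.integrable_normed
          (Filter.Eventually.of_forall fun t => φ.nonneg_normed t), φ.integral_normed]
        simp

/-- Mollifications of an integrable function converge in `L¹`. -/
theorem tendsto_lintegral_enorm_convolution_sub [FiniteDimensional ℝ E]
    {φ : ℕ → ContDiffBump (0 : Plane)} (hφ : Tendsto (fun n => (φ n).rOut) atTop (𝓝 0))
    {f : Plane → E} (hf : Integrable f) :
    Tendsto (fun n => ∫⁻ x, ‖((φ n).normed volume ⋆[lsmul ℝ ℝ, volume] f) x - f x‖ₑ) atTop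
      (𝓝 0) := by
  have : CompleteSpace E := FiniteDimensional.complete ℝ E
  rw [ENNReal.tendsto_nhds_zero]
  intro ε hε
  -- An `ε/3` argument: mollification contracts `L¹`, so it suffices to treat a continuous compactly
  -- supported `ψ`, for which dominated convergence applies on the 1-neighbourhood of its support.
  obtain ⟨ψ, hψs, hψf, hψc, hψi⟩ := hf.exists_hasCompactSupport_lintegral_sub_le
    (ε := ε / 3) (ENNReal.div_pos hε.ne' (by simp)).ne'
  have hmid : Tendsto (fun n => ∫⁻ x, ‖((φ n).normed volume ⋆[lsmul ℝ ℝ, volume] ψ) x - ψ x‖ₑ)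
      atTop (𝓝 0) := by
    obtain ⟨C, hC⟩ := hψs.exists_bound_of_continuous hψc
    set S := Metric.cthickening 1 (tsupport ψ)
    have hS : IsCompact S := hψs.isCompact.cthickening
    have hdom := tendsto_lintegral_filter_of_dominated_convergence (μ := volume)
      (F := fun n x => ‖((φ n).normed volume ⋆[lsmul ℝ ℝ, volume] ψ) x - ψ x‖ₑ) (f := fun _ => 0)
      (l := atTop) (S.indicator fun _ => ENNReal.ofReal (2 * C)) ?_ ?_ ?_ ?_
    · simpa using hdom
    · refine Filter.Eventually.of_forall fun n => ?_
      have hc : Continuous ((φ n).normed volume ⋆[lsmul ℝ ℝ, volume] ψ) :=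
        (φ n).hasCompactSupport_normed.continuous_convolution_left _ (φ n).continuous_normed
          hψi.locallyIntegrable
      exact (hc.sub hψc).enorm.measurable
    · filter_upwards [hφ.eventually (gt_mem_nhds one_pos)] with n hn
      refine Filter.Eventually.of_forall fun x => ?_
      by_cases hx : x ∈ S
      · rw [indicator_of_mem hx, ← ofReal_norm]
        apply ENNReal.ofReal_le_ofReal
        rw [← dist_eq_norm]
        apply (φ n).dist_normed_convolution_le hψc.aestronglyMeasurable
        intro y _
        rw [dist_eq_norm]
        exact (norm_sub_le _ _).trans (by linarith [hC x, hC y])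
      · rw [indicator_of_notMem hx]
        have hz : ∀ y ∈ Metric.ball x 1, ψ y = 0 := fun y hy => by
          by_contra hne
          exact hx (Metric.mem_cthickening_of_dist_le x y 1 _ (subset_tsupport _ hne)
            (by rw [dist_comm]; exact (Metric.mem_ball.1 hy).le))
        rw [(φ n).normed_convolution_eq_right (fun y hy => by
          rw [hz y (Metric.ball_subset_ball hn.le hy), hz x (Metric.mem_ball_self one_pos)])]
        simp
    · rw [lintegral_indicator hS.measurableSet, setLIntegral_const]
      exact ENNReal.mul_ne_top ENNReal.ofReal_ne_top hS.measure_lt_top.ne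
    · refine Filter.Eventually.of_forall fun x => ?_
      have h := ContDiffBump.convolution_tendsto_right_of_continuous (μ := volume) hφ hψc x
      have h' := (h.sub_const (ψ x)).enorm
      simpa using h'
  filter_upwards [(ENNReal.tendsto_nhds_zero.1 hmid) (ε / 3) (ENNReal.div_pos hε.ne' (by simp))]
    with n hn
  set η := (φ n).normed volume
  have hex : ∀ {F : Plane → E}, Integrable F → ConvolutionExists η F (lsmul ℝ ℝ) volume :=
    fun hF => (φ n).hasCompactSupport_normed.convolutionExists_left _ (φ n).continuous_normed
      hF.locallyIntegrable
  have hsplit : ∀ x, (η ⋆[lsmul ℝ ℝ, volume] f) x - f x =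
      (η ⋆[lsmul ℝ ℝ, volume] (f - ψ)) x + ((η ⋆[lsmul ℝ ℝ, volume] ψ) x - ψ x) + (ψ x - f x) := by
    intro x
    have h := (hex (hf.sub hψi) x).distrib_add (hex hψi x)
    rw [sub_add_cancel] at h
    rw [h]
    abel
  have hmeas : ∀ {F : Plane → E}, Integrable F →
      AEMeasurable (fun x => ‖(η ⋆[lsmul ℝ ℝ, volume] F) x‖ₑ) := fun hF =>
    ((φ n).hasCompactSupport_normed.continuous_convolution_left _ (φ n).continuous_normed
          hF.locallyIntegrable).enorm.measurable.aemeasurable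
  have hm2 : AEMeasurable (fun x => ‖(ψ x - f x)‖ₑ) :=
    (hψi.sub hf).aestronglyMeasurable.enorm
  have h1 := lintegral_enorm_convolution_pow_le (φ n) (hf.sub hψi).aestronglyMeasurable le_rfl
  simp only [pow_one] at h1
  calc _ ≤ ∫⁻ x, (‖(η ⋆[lsmul ℝ ℝ, volume] (f - ψ)) x‖ₑ +
        ‖(η ⋆[lsmul ℝ ℝ, volume] ψ) x - ψ x‖ₑ + ‖ψ x - f x‖ₑ) := by
        refine lintegral_mono fun x => ?_
        rw [hsplit]
        exact (enorm_add_le _ _).trans (add_le_add_left (enorm_add_le _ _) _)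
    _ = (∫⁻ x, ‖(η ⋆[lsmul ℝ ℝ, volume] (f - ψ)) x‖ₑ) +
        (∫⁻ x, ‖(η ⋆[lsmul ℝ ℝ, volume] ψ) x - ψ x‖ₑ) + ∫⁻ x, ‖ψ x - f x‖ₑ := by
        rw [lintegral_add_right' _ hm2, lintegral_add_left' (hmeas (hf.sub hψi))]
    _ ≤ ε / 3 + ε / 3 + ε / 3 := by
        refine add_le_add (add_le_add (h1.trans hψf) hn) (le_trans (le_of_eq ?_) hψf)
        exact lintegral_congr fun x => enorm_sub_rev _ _
    _ = ε := ENNReal.add_thirds ε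

end Convolution

/-- The derivative of the mollification of a function is the mollification of its weak gradient. -/
theorem IsWeakGradient.fderiv_convolution {U : Set Plane} {u : Plane → ℝ} {g : Plane → Plane}
    (h : IsWeakGradient U u g) {K : Set Plane} (hK : IsCompact K) (hKU : K ⊆ U)
    (φ : ContDiffBump (0 : Plane)) {x : Plane} (hx : Metric.closedBall x φ.rOut ⊆ K) :
    fderiv ℝ (φ.normed volume ⋆[lsmul ℝ ℝ, volume] K.indicator u) x =
      innerSL ℝ ((φ.normed volume ⋆[lsmul ℝ ℝ, volume] K.indicator g) x) := by
  obtain ⟨hu, hg, hug⟩ := h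
  have hu0 : Integrable (K.indicator u) :=
    (integrable_indicator_iff hK.measurableSet).2 (hu.integrableOn_compact_subset hKU hK)
  have hg0 : Integrable (K.indicator g) :=
    (integrable_indicator_iff hK.measurableSet).2 (hg.integrableOn_compact_subset hKU hK)
  set η := φ.normed volume with hη
  have hηs : ContDiff ℝ ∞ η := φ.contDiff_normed
  have hηc : HasCompactSupport η := φ.hasCompactSupport_normed
  -- Differentiating the convolution puts the derivative on the kernel. The reflected kernel `ψ` is
  -- supported in `K ⊆ U`, hence a legitimate test function for the weak gradient.
  set ψ : Plane → ℝ := fun y => η (x - y) with hψ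
  have hψs : ContDiff ℝ ∞ ψ := hηs.comp (contDiff_const.sub contDiff_id)
  have hψt : tsupport ψ ⊆ Metric.closedBall x φ.rOut := by
    refine closure_minimal (fun y hy => ?_) Metric.isClosed_closedBall
    have : x - y ∈ Function.support η := hy
    rw [hη, φ.support_normed_eq] at this
    rw [Metric.mem_closedBall, dist_comm, dist_eq_norm]
    simpa using (mem_ball_zero_iff.1 this).le
  have hψc : HasCompactSupport ψ :=
    (isCompact_closedBall x φ.rOut).of_isClosed_subset (isClosed_tsupport _) hψt
  have hψd : ∀ y v, fderiv ℝ ψ y v = -fderiv ℝ η (x - y) v := fun y v => by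
    have h1 : HasFDerivAt (fun y : Plane => x - y) (-ContinuousLinearMap.id ℝ Plane) y := by
      simpa using (hasFDerivAt_id y).const_sub x
    have h2 := ((hηs.differentiable (by simp)) (x - y)).hasFDerivAt.comp y h1
    rw [show ψ = η ∘ fun y => x - y from rfl, h2.fderiv]
    simp
  have hder := hηc.hasFDerivAt_convolution_left (lsmul ℝ ℝ) (hηs.of_le (by simp))
    hu0.locallyIntegrable x
  rw [hder.fderiv]
  have hbasis : ∀ i : Fin 2,
      ((fderiv ℝ η ⋆[(lsmul ℝ ℝ).precompL Plane, volume] K.indicator u) x)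
          (EuclideanSpace.single i 1) =
        ((η ⋆[lsmul ℝ ℝ, volume] K.indicator g) x) i := by
    intro i
    have hex1 : Integrable fun t => ((lsmul ℝ ℝ : ℝ →L[ℝ] ℝ →L[ℝ] ℝ).precompL Plane)
        (fderiv ℝ η (x - t)) (K.indicator u t) := by
      have := ((hηc.fderiv ℝ).convolutionExists_left ((lsmul ℝ ℝ : ℝ →L[ℝ] ℝ →L[ℝ] ℝ).precompL Plane)
        (hηs.continuous_fderiv (by simp)) hu0.locallyIntegrable x)
      exact this.integrable_swap
    have hex2 : Integrable fun t => (lsmul ℝ ℝ : ℝ →L[ℝ] Plane →L[ℝ] Plane)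
        (η (x - t)) (K.indicator g t) :=
      (hηc.convolutionExists_left _ hηs.continuous hg0.locallyIntegrable x).integrable_swap
    have hweak := hug ψ hψs hψc (hψt.trans (hx.trans hKU)) i
    have hKo : ∀ y, y ∉ K → ψ y = 0 := fun y hy => by
      by_contra hne
      exact hy (hx (hψt (subset_tsupport _ hne)))
    have hKo' : ∀ y, y ∉ K → fderiv ℝ ψ y = 0 := fun y hy => by
      by_contra hne
      exact hy (hx (hψt (support_fderiv_subset ℝ hne)))
    rw [convolution_eq_swap, convolution_eq_swap, ContinuousLinearMap.integral_apply hex1]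
    have hproj := (EuclideanSpace.proj (𝕜 := ℝ) i).integral_comp_comm hex2
    refine Eq.trans ?_ hproj
    simp only [EuclideanSpace.coe_proj]
    have hUm : ∀ f : Plane → ℝ, (∀ y, y ∉ K → f y = 0) → ∫ y in U, f y = ∫ y, f y :=
      fun f hf => setIntegral_eq_integral_of_forall_compl_eq_zero fun y hy =>
        hf y fun hyK => hy (hKU hyK)
    rw [hUm _ (fun y hy => by simp [hKo' y hy]), hUm _ (fun y hy => by simp [hKo y hy])] at hweak
    have e1 : ∀ y, ((lsmul ℝ ℝ : ℝ →L[ℝ] ℝ →L[ℝ] ℝ).precompL Plane)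
        (fderiv ℝ η (x - y)) (K.indicator u y) (EuclideanSpace.single i 1) =
        -(u y * fderiv ℝ ψ y (EuclideanSpace.single i 1)) := fun y => by
      rw [hψd]
      by_cases hy : y ∈ K
      · simp [ContinuousLinearMap.precompL_apply, indicator_of_mem hy, mul_comm]
      · have := hψd y (EuclideanSpace.single i 1)
        rw [hKo' y hy] at this
        simp only [zero_apply] at this
        rw [← this]
        simp [indicator_of_notMem hy]
    have e2 : ∀ y, ((lsmul ℝ ℝ : ℝ →L[ℝ] Plane →L[ℝ] Plane) (η (x - y)) (K.indicator g y)) i =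
        g y i * ψ y := fun y => by
      by_cases hy : y ∈ K
      · simp [indicator_of_mem hy, hψ, mul_comm]
      · simp [indicator_of_notMem hy, hKo y hy]
    simp only [e1, e2]
    rw [integral_neg, hweak, neg_neg]
  have hlin : ((fderiv ℝ η ⋆[(lsmul ℝ ℝ).precompL Plane, volume] K.indicator u) x).toLinearMap =
      (innerSL ℝ ((η ⋆[lsmul ℝ ℝ, volume] K.indicator g) x)).toLinearMap := by
    refine (EuclideanSpace.basisFun (Fin 2) ℝ).toBasis.ext fun i => ?_
    have := hbasis i
    simp only [OrthonormalBasis.coe_toBasis, EuclideanSpace.basisFun_apply]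
    simpa [EuclideanSpace.inner_single_right] using this
  exact ContinuousLinearMap.coe_injective hlin

/-- Approximation of a function with a weak gradient by smooth functions near a compact set. -/
theorem IsWeakGradient.exists_smooth_approx {U : Set Plane} (hU : IsOpen U) {u : Plane → ℝ}
    {g : Plane → Plane} (h : IsWeakGradient U u g) {K : Set Plane} (hK : IsCompact K)
    (hKU : K ⊆ U) :
    ∃ (w : ℕ → Plane → ℝ) (G : ℕ → Plane → Plane),
      (∀ n, ContDiff ℝ ∞ (w n)) ∧ (∀ n, HasCompactSupport (w n)) ∧
      (∀ n, ∀ x ∈ K, fderiv ℝ (w n) x = innerSL ℝ (G n x)) ∧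
      (∀ n, ∫⁻ x in K, ‖w n x‖ₑ ^ 2 ≤ ∫⁻ x in U, ‖u x‖ₑ ^ 2) ∧
      (∀ n, ∫⁻ x in K, ‖G n x‖ₑ ^ 2 ≤ ∫⁻ x in U, ‖g x‖ₑ ^ 2) ∧
      Tendsto (fun n => ∫⁻ x in K, ‖w n x - u x‖ₑ) atTop (𝓝 0) ∧
      Tendsto (fun n => ∫⁻ x in K, ‖G n x - g x‖ₑ) atTop (𝓝 0) ∧
      ∀ x ∈ K, ContinuousAt u x → Tendsto (fun n => w n x) atTop (𝓝 (u x)) := by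
  obtain ⟨r, hr, hrU⟩ := hK.exists_cthickening_subset_open hU hKU
  -- Cutting off to a neighbourhood of `K` still inside `U` makes the functions integrable and
  -- leaves the mollifications on `K` unaffected by the cut, since all radii are at most `r`.
  set K' := Metric.cthickening r K
  have hK' : IsCompact K' := hK.cthickening
  have hKK' : K ⊆ K' := Metric.self_subset_cthickening K
  have hu0 : Integrable (K'.indicator u) :=
    (integrable_indicator_iff hK'.measurableSet).2 (h.1.integrableOn_compact_subset hrU hK')
  have hg0 : Integrable (K'.indicator g) :=
    (integrable_indicator_iff hK'.measurableSet).2 (h.2.1.integrableOn_compact_subset hrU hK')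
  let φ : ℕ → ContDiffBump (0 : Plane) := fun n =>
    ⟨r / (n + 1) / 2, r / (n + 1), by positivity, half_lt_self (by positivity)⟩
  have hφr : ∀ n, (φ n).rOut = r / (n + 1) := fun n => rfl
  have hφle : ∀ n, (φ n).rOut ≤ r := fun n => by
    rw [hφr]; exact div_le_self hr.le (by linarith [n.cast_nonneg (α := ℝ)])
  have hφ : Tendsto (fun n => (φ n).rOut) atTop (𝓝 0) := by
    simp only [hφr]
    exact tendsto_const_div_atTop_nhds_zero_nat r |>.comp (Filter.tendsto_add_atTop_nat 1) |>.congr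
      fun n => by simp
  have hball : ∀ n, ∀ x ∈ K, Metric.closedBall x (φ n).rOut ⊆ K' := fun n x hx =>
    (Metric.closedBall_subset_closedBall (hφle n)).trans
      (Metric.closedBall_subset_cthickening hx r)
  have hL2 : ∀ {E : Type} [NormedAddCommGroup E] [NormedSpace ℝ E] (f : Plane → E),
      Integrable (K'.indicator f) → ∀ n,
      ∫⁻ x in K, ‖((φ n).normed volume ⋆[lsmul ℝ ℝ, volume] K'.indicator f) x‖ₑ ^ 2 ≤
        ∫⁻ x in U, ‖f x‖ₑ ^ 2 := by
    intro E _ _ f hf n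
    refine (setLIntegral_le_lintegral _ _).trans
      ((lintegral_enorm_convolution_pow_le (φ n) hf.aestronglyMeasurable one_le_two).trans ?_)
    calc ∫⁻ x, ‖K'.indicator f x‖ₑ ^ 2 = ∫⁻ x in K', ‖f x‖ₑ ^ 2 := by
          rw [← lintegral_indicator hK'.measurableSet]
          refine lintegral_congr fun x => ?_
          by_cases hx : x ∈ K' <;> simp [hx]
      _ ≤ _ := lintegral_mono_set hrU
  have hL1 : ∀ {E : Type} [NormedAddCommGroup E] [NormedSpace ℝ E] [FiniteDimensional ℝ E]
      (f : Plane → E), Integrable (K'.indicator f) →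
      Tendsto (fun n => ∫⁻ x in K,
        ‖((φ n).normed volume ⋆[lsmul ℝ ℝ, volume] K'.indicator f) x - f x‖ₑ) atTop (𝓝 0) := by
    intro E _ _ _ f hf
    refine tendsto_of_tendsto_of_tendsto_of_le_of_le tendsto_const_nhds
      (tendsto_lintegral_enorm_convolution_sub hφ hf) (fun _ => zero_le) fun n => ?_
    refine le_trans (le_of_eq ?_) (setLIntegral_le_lintegral K _)
    exact setLIntegral_congr_fun hK.measurableSet fun x hx => by
      simp only [indicator_of_mem (hKK' hx)]
  refine ⟨fun n => (φ n).normed volume ⋆[lsmul ℝ ℝ, volume] K'.indicator u,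
    fun n => (φ n).normed volume ⋆[lsmul ℝ ℝ, volume] K'.indicator g, fun n => ?_, fun n => ?_,
    fun n x hx => h.fderiv_convolution hK' hrU (φ n) (hball n x hx), hL2 u hu0, hL2 g hg0,
    hL1 u hu0, hL1 g hg0, fun x hx hc => ?_⟩
  · exact (φ n).hasCompactSupport_normed.contDiff_convolution_left _ (φ n).contDiff_normed
      hu0.locallyIntegrable
  · refine (φ n).hasCompactSupport_normed.convolution _
      (hK'.of_isClosed_subset (isClosed_tsupport _) ?_)
    exact closure_minimal (Function.support_subset_iff'.2 fun y hy => indicator_of_notMem hy _)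
      hK'.isClosed
  · have hev : K'.indicator u =ᶠ[𝓝 x] u := by
      filter_upwards [Metric.ball_mem_nhds x hr] with y hy
      exact indicator_of_mem (Metric.closedBall_subset_cthickening hx r
        (Metric.ball_subset_closedBall hy)) _
    have h1 : Tendsto (K'.indicator u) (𝓝 x) (𝓝 (u x)) := hc.tendsto.congr' hev.symm
    exact ContDiffBump.convolution_tendsto_right hφ
      (Filter.Eventually.of_forall fun _ => hu0.aestronglyMeasurable)
      (h1.comp Filter.tendsto_snd) tendsto_const_nhds

/-! ### Geometry maps: change of variables and the weak chain rule -/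

theorem isOpen_unitSquare : IsOpen unitSquare := by
  have : unitSquare = ⋂ i, (fun x : Plane => x i) ⁻¹' Ioo (0 : ℝ) 1 := by
    ext; simp [unitSquare]
  rw [this]
  exact isOpen_iInter_of_finite fun i => isOpen_Ioo.preimage (by fun_prop)

/-- A lower bound for the determinant of a linear isomorphism of the plane by the norm of its
inverse. -/
theorem one_le_sq_mul_abs_det (A : Plane ≃L[ℝ] Plane) {B : ℝ}
    (hB : ‖(A.symm : Plane →L[ℝ] Plane)‖ ≤ B) :
    1 ≤ B ^ 2 * |(A : Plane →L[ℝ] Plane).det| := by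
  have hB0 : 0 ≤ B := (norm_nonneg _).trans hB
  -- Comparing areas: `A⁻¹` maps the unit disc into a disc of radius `B`, so `|det A⁻¹| ≤ B²`.
  have hsub : (A.symm : Plane →L[ℝ] Plane) '' Metric.ball 0 1 ⊆ Metric.closedBall 0 B := by
    rintro _ ⟨x, hx, rfl⟩
    rw [mem_closedBall_zero_iff]
    have hx' := (mem_ball_zero_iff.1 hx).le
    calc _ ≤ ‖(A.symm : Plane →L[ℝ] Plane)‖ * ‖x‖ := ContinuousLinearMap.le_opNorm _ _
      _ ≤ B * 1 := by gcongr
      _ = B := mul_one B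
  have h1 := measure_mono (μ := volume) hsub
  rw [Measure.addHaar_image_continuousLinearMap, Measure.addHaar_closedBall _ _ hB0,
    ENNReal.mul_le_mul_iff_left (Metric.measure_ball_pos _ _ one_pos).ne' measure_ball_lt_top.ne,
    ENNReal.ofReal_le_ofReal_iff (by positivity)] at h1
  have h2 : LinearMap.det ((A.symm : Plane →L[ℝ] Plane) : Plane →ₗ[ℝ] Plane) =
      (A : Plane →L[ℝ] Plane).det⁻¹ := A.det_coe_symm
  have h3 : (A : Plane →L[ℝ] Plane).det ≠ 0 := A.toLinearEquiv.isUnit_det'.ne_zero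
  rw [h2, abs_inv, inv_le_iff_one_le_mul₀ (abs_pos.2 h3)] at h1
  simpa using h1

/-- A geometry map may be assumed to be Lipschitz on the whole plane. -/
theorem IsGeometryMap.exists_lipschitzWith {G : Plane → Plane} {C H : ℝ}
    (hG : IsGeometryMap G C H) :
    ∃ (G' : Plane → Plane) (L : ℝ≥0), LipschitzWith L G' ∧ EqOn G' G unitSquare ∧
      IsGeometryMap G' C H := by
  obtain ⟨L, hL⟩ := hG.lipschitz
  obtain ⟨G', hG', heq'⟩ := hL.extend_finite_dimension
  have heq : EqOn G' G unitSquare := fun x hx => by rw [heq' hx]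
  refine ⟨G', _, hG', heq, hG.injOn.congr heq.symm, ?_, ⟨_, hG'.lipschitzOnWith⟩, ?_⟩
  · rw [heq.image_eq]; exact hG.isOpen_image
  · filter_upwards [hG.fderiv_bound, ae_restrict_mem isOpen_unitSquare.measurableSet]
      with x ⟨A, hA, hA'⟩ hx
    refine ⟨A, hA.congr_of_eventuallyEq ?_, hA'⟩
    filter_upwards [isOpen_unitSquare.mem_nhds hx] with y hy using heq hy

section

variable {G : Plane → Plane} {C H : ℝ} {L : ℝ≥0}

/-- The change of variables estimate for geometry maps. -/
theorem IsGeometryMap.map_restrict_le (hG : IsGeometryMap G C H) (hL : LipschitzWith L G)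
    {K : Set Plane} (hK : MeasurableSet K) (hKU : K ⊆ unitSquare) :
    (volume.restrict K).map G ≤ ENNReal.ofReal ((C / H) ^ 2) • volume.restrict (G '' K) := by
  have hGm : Measurable G := hL.continuous.measurable
  refine Measure.le_iff.2 fun N hN => ?_
  have hb := (ae_restrict_iff' isOpen_unitSquare.measurableSet).1 hG.fderiv_bound
  -- Outside the null set `Z` the map is differentiable with `|det ∇G| ≥ (C/H)⁻²`, and the area
  -- formula for injective maps applies.
  obtain ⟨Z, hZsub, hZm, hZ0⟩ := exists_measurable_superset_of_null (ae_iff.1 hb)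
  have hgood : ∀ x ∈ K ∩ Zᶜ, ∃ A : Plane ≃L[ℝ] Plane,
      HasFDerivAt G (A : Plane →L[ℝ] Plane) x ∧ ‖(A : Plane →L[ℝ] Plane)‖ ≤ C * H ∧
        ‖(A.symm : Plane →L[ℝ] Plane)‖ ≤ C / H := fun x hx => by
    by_contra hne
    exact hx.2 (hZsub fun h => hne (h (hKU hx.1)))
  set T := K ∩ Zᶜ ∩ G ⁻¹' N
  have hT : MeasurableSet T := (hK.inter hZm.compl).inter (hGm hN)
  have h1 : volume (G ⁻¹' N ∩ K) ≤ volume T := by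
    have : G ⁻¹' N ∩ K ⊆ T ∪ Z := fun x hx => by
      by_cases hxZ : x ∈ Z
      · exact Or.inr hxZ
      · exact Or.inl ⟨⟨hx.2, hxZ⟩, hx.1⟩
    calc _ ≤ volume (T ∪ Z) := measure_mono this
      _ ≤ volume T + volume Z := measure_union_le _ _
      _ = volume T := by rw [hZ0, add_zero]
  have h2 : volume T ≤ ENNReal.ofReal ((C / H) ^ 2) *
      ∫⁻ x in T, ENNReal.ofReal |(fderiv ℝ G x).det| := by
    rw [← lintegral_const_mul' _ _ ENNReal.ofReal_ne_top, ← setLIntegral_one]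
    refine setLIntegral_mono' hT fun x hx => ?_
    obtain ⟨A, hA, -, hA'⟩ := hgood x hx.1
    rw [hA.fderiv, ← ENNReal.ofReal_mul (sq_nonneg _), ← ENNReal.ofReal_one]
    exact ENNReal.ofReal_le_ofReal (one_le_sq_mul_abs_det A hA')
  rw [lintegral_abs_det_fderiv_eq_addHaar_image volume hT (fun x hx => by
    obtain ⟨A, hA, -⟩ := hgood x hx.1
    rw [hA.fderiv]
    exact hA.hasFDerivWithinAt) (hG.injOn.mono fun x hx => hKU hx.1.1)] at h2
  have h3 : volume (G '' T) ≤ volume (N ∩ G '' K) := measure_mono (by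
    rintro _ ⟨x, hx, rfl⟩
    exact ⟨hx.2, mem_image_of_mem _ hx.1.1⟩)
  rw [Measure.map_apply hGm hN, Measure.restrict_apply (hGm hN), Measure.smul_apply,
    Measure.restrict_apply hN, smul_eq_mul]
  exact h1.trans (h2.trans (by gcongr))

/-- The measure inequality also makes the push-forward absolutely continuous, which is why almost
everywhere measurability of `F` on the image is enough. -/
theorem IsGeometryMap.lintegral_comp_le (hG : IsGeometryMap G C H) (hL : LipschitzWith L G)
    {K : Set Plane} (hK : MeasurableSet K) (hKU : K ⊆ unitSquare) {F : Plane → ℝ≥0∞}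
    (hF : AEMeasurable F (volume.restrict (G '' K))) :
    ∫⁻ x in K, F (G x) ≤ ENNReal.ofReal ((C / H) ^ 2) * ∫⁻ y in G '' K, F y := by
  have hle := hG.map_restrict_le hL hK hKU
  have hac : (volume.restrict K).map G ≪ volume.restrict (G '' K) :=
    (Measure.absolutelyContinuous_of_le hle).trans Measure.smul_absolutelyContinuous
  rw [← lintegral_map' (hF.mono_ac hac) hL.continuous.aemeasurable, ← smul_eq_mul,
    ← lintegral_smul_measure]
  exact lintegral_mono' hle le_rfl

theorem IsGeometryMap.aestronglyMeasurable_comp (hG : IsGeometryMap G C H)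
    (hL : LipschitzWith L G) {K : Set Plane} (hK : MeasurableSet K) (hKU : K ⊆ unitSquare)
    {E : Type*} [TopologicalSpace E] {f : Plane → E}
    (hf : AEStronglyMeasurable f (volume.restrict (G '' K))) :
    AEStronglyMeasurable (fun x => f (G x)) (volume.restrict K) := by
  have hac : (volume.restrict K).map G ≪ volume.restrict (G '' K) :=
    (Measure.absolutelyContinuous_of_le (hG.map_restrict_le hL hK hKU)).trans
      Measure.smul_absolutelyContinuous
  exact (hf.mono_ac hac).comp_measurable hL.continuous.measurable

/-- The pull-back of a vector field by a geometry map. -/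
noncomputable def pullback (G : Plane → Plane) (g : Plane → Plane) (x : Plane) : Plane :=
  (fderiv ℝ G x).adjoint (g (G x))

theorem IsGeometryMap.norm_fderiv_le (hG : IsGeometryMap G C H) :
    ∀ᵐ x ∂volume.restrict unitSquare, DifferentiableAt ℝ G x ∧ ‖fderiv ℝ G x‖ ≤ C * H := by
  filter_upwards [hG.fderiv_bound] with x ⟨A, hA, hA', _⟩
  rw [hA.fderiv]
  exact ⟨hA.differentiableAt, hA'⟩

theorem IsGeometryMap.enorm_pullback_le (hG : IsGeometryMap G C H) (g : Plane → Plane) :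
    ∀ᵐ x ∂volume.restrict unitSquare,
      ‖pullback G g x‖ₑ ≤ ENNReal.ofReal (C * H) * ‖g (G x)‖ₑ := by
  filter_upwards [hG.norm_fderiv_le] with x hx
  rw [← ofReal_norm, ← ofReal_norm,
    ← ENNReal.ofReal_mul ((norm_nonneg _).trans hx.2)]
  apply ENNReal.ofReal_le_ofReal
  refine (ContinuousLinearMap.le_opNorm _ _).trans ?_
  rw [LinearIsometryEquiv.norm_map]
  gcongr
  exact hx.2

theorem IsGeometryMap.aestronglyMeasurable_pullback (hG : IsGeometryMap G C H)
    (hL : LipschitzWith L G) {K : Set Plane} (hK : MeasurableSet K) (hKU : K ⊆ unitSquare)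
    {g : Plane → Plane} (hg : AEStronglyMeasurable g (volume.restrict (G '' K))) :
    AEStronglyMeasurable (pullback G g) (volume.restrict K) := by
  have h1 : AEStronglyMeasurable (fun x => (fderiv ℝ G x).adjoint) (volume.restrict K) :=
    (ContinuousLinearMap.adjoint (𝕜 := ℝ) (E := Plane) (F := Plane)).continuous.comp_aestronglyMeasurable
      (measurable_fderiv ℝ G).aestronglyMeasurable
  exact isBoundedBilinearMap_apply.continuous.comp_aestronglyMeasurable
    (h1.prodMk (hG.aestronglyMeasurable_comp hL hK hKU hg))

/-- The chain rule for weak gradients and geometry maps. -/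
theorem IsGeometryMap.isWeakGradient_pullback (hG : IsGeometryMap G C H)
    (hL : LipschitzWith L G) {u : Plane → ℝ} {g : Plane → Plane}
    (h : IsWeakGradient (G '' unitSquare) u g) :
    IsWeakGradient unitSquare (fun x => u (G x)) (pullback G g) := by
  have hsq := isOpen_unitSquare
  have hcomp : ∀ {K : Set Plane}, IsCompact K → IsCompact (G '' K) :=
    fun hK => hK.image hL.continuous
  have huK : ∀ {K : Set Plane}, IsCompact K → K ⊆ unitSquare →
      IntegrableOn u (G '' K) := fun hK hKU =>
    h.1.integrableOn_compact_subset (image_mono hKU) (hcomp hK)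
  have hgK : ∀ {K : Set Plane}, IsCompact K → K ⊆ unitSquare →
      IntegrableOn g (G '' K) := fun hK hKU =>
    h.2.1.integrableOn_compact_subset (image_mono hKU) (hcomp hK)
  refine ⟨(locallyIntegrableOn_iff hsq.isLocallyClosed).2 fun K hKU hK => ?_,
    (locallyIntegrableOn_iff hsq.isLocallyClosed).2 fun K hKU hK => ?_, fun φ hφ hφc hφU i => ?_⟩
  · refine ⟨hG.aestronglyMeasurable_comp hL hK.measurableSet hKU
      (huK hK hKU).aestronglyMeasurable, ?_⟩
    exact (hG.lintegral_comp_le hL hK.measurableSet hKU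
      (huK hK hKU).aestronglyMeasurable.enorm).trans_lt
        (ENNReal.mul_lt_top ENNReal.ofReal_lt_top (huK hK hKU).2)
  · refine ⟨hG.aestronglyMeasurable_pullback hL hK.measurableSet hKU
      (hgK hK hKU).aestronglyMeasurable, ?_⟩
    have h1 := ae_restrict_of_ae_restrict_of_subset hKU (hG.enorm_pullback_le g)
    refine (lintegral_mono_ae h1).trans_lt ?_
    rw [lintegral_const_mul' _ _ ENNReal.ofReal_ne_top]
    exact ENNReal.mul_lt_top ENNReal.ofReal_lt_top
      ((hG.lintegral_comp_le hL hK.measurableSet hKU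
        (hgK hK hKU).aestronglyMeasurable.enorm).trans_lt
          (ENNReal.mul_lt_top ENNReal.ofReal_lt_top (hgK hK hKU).2))
  · set K := tsupport φ
    have hK : IsCompact K := hφc
    have hKm := hK.measurableSet
    set e : Plane := EuclideanSpace.single i 1
    -- The smooth `w n` approximate `u` on `G(K)`, where `K` is the support of the test function.
    -- Each `w n ∘ G` is Lipschitz, so the classical identity holds for it and only two `L¹` limits
    -- remain.
    obtain ⟨w, D, hw, hwc, hwD, -, -, hwu, hDg, -⟩ :=
      h.exists_smooth_approx hG.isOpen_image (hcomp hK) (image_mono hφU)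
    obtain ⟨Lφ, hLφ⟩ := ContDiff.lipschitzWith_of_hasCompactSupport hφc hφ (by simp)
    have hwL : ∀ n, ∃ Ln, LipschitzWith Ln fun x => w n (G x) := fun n => by
      obtain ⟨Ln, hLn⟩ := ContDiff.lipschitzWith_of_hasCompactSupport (hwc n) (hw n) (by simp)
      exact ⟨_, hLn.comp hL⟩
    have hφd : Differentiable ℝ φ := hφ.differentiable (by simp)
    have hφ'c : Continuous fun x => fderiv ℝ φ x e :=
      (hφ.continuous_fderiv (by simp)).clm_apply continuous_const
    have hoff : ∀ x ∉ K, φ x = 0 := fun x hx => image_eq_zero_of_notMem_tsupport hx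
    have hoff' : ∀ x ∉ K, fderiv ℝ φ x e = 0 := fun x hx => by
      rw [fderiv_of_notMem_tsupport ℝ hx]; rfl
    have hsqK : ∀ f : Plane → ℝ, (∀ x ∉ K, f x = 0) → ∫ x in unitSquare, f x = ∫ x in K, f x :=
      fun f hf => by
        rw [setIntegral_eq_integral_of_forall_compl_eq_zero fun x hx => hf x fun hxK => hx (hφU hxK),
          setIntegral_eq_integral_of_forall_compl_eq_zero fun x hx => hf x hx]
    obtain ⟨M, hM⟩ := hφc.exists_bound_of_continuous hφ.continuous
    obtain ⟨M', hM'⟩ := (hφc.fderiv_apply (𝕜 := ℝ) e).exists_bound_of_continuous hφ'c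
    have hφle : ∀ x, ‖φ x‖ₑ ≤ ENNReal.ofReal M := fun x => by
      rw [← ofReal_norm]; exact ENNReal.ofReal_le_ofReal (hM x)
    have hφ'le : ∀ x, ‖fderiv ℝ φ x e‖ₑ ≤ ENNReal.ofReal M' := fun x => by
      rw [← ofReal_norm]; exact ENNReal.ofReal_le_ofReal (hM' x)
    have hparts : ∀ n, ∫ x in K, w n (G x) * fderiv ℝ φ x e =
        -∫ x in K, lineDeriv ℝ (fun x => w n (G x)) x e * φ x := fun n => by
      obtain ⟨Ln, hLn⟩ := hwL n
      have h1 := hLn.integral_lineDeriv_mul_eq (μ := volume) hLφ hφc e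
      rw [setIntegral_eq_integral_of_forall_compl_eq_zero fun x hx => by rw [hoff' x hx, mul_zero],
        setIntegral_eq_integral_of_forall_compl_eq_zero fun x hx => by rw [hoff x hx, mul_zero], h1,
        ← integral_neg]
      refine integral_congr_ae (Filter.Eventually.of_forall fun x => ?_)
      simp only [(hφd x).lineDeriv_eq_fderiv, map_neg]
      ring
    have hlim1 : Tendsto (fun n => ∫ x in K, w n (G x) * fderiv ℝ φ x e) atTop
        (𝓝 (∫ x in K, u (G x) * fderiv ℝ φ x e)) := by
      apply tendsto_integral_of_L1
      · exact (hG.aestronglyMeasurable_comp hL hKm hφU (huK hK hφU).aestronglyMeasurable).mul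
          hφ'c.aestronglyMeasurable
      · refine Filter.Eventually.of_forall fun n => ?_
        exact (((hw n).continuous.comp hL.continuous).mul hφ'c).continuousOn.integrableOn_compact hK
      · have hz : Tendsto (fun n => ENNReal.ofReal M' * (ENNReal.ofReal ((C / H) ^ 2) *
            ∫⁻ y in G '' K, ‖w n y - u y‖ₑ)) atTop (𝓝 0) := by
          have := ENNReal.Tendsto.const_mul (ENNReal.Tendsto.const_mul hwu
            (Or.inr (ENNReal.ofReal_ne_top (r := (C / H) ^ 2))))
            (Or.inr (ENNReal.ofReal_ne_top (r := M')))
          simpa using this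
        refine tendsto_of_tendsto_of_tendsto_of_le_of_le tendsto_const_nhds hz
          (fun _ => zero_le) fun n => ?_
        calc _ ≤ ∫⁻ x in K, ENNReal.ofReal M' * ‖w n (G x) - u (G x)‖ₑ := by
              refine lintegral_mono fun x => ?_
              rw [← sub_mul, enorm_mul, mul_comm]
              gcongr
              exact hφ'le x
          _ ≤ _ := by
              rw [lintegral_const_mul' _ _ ENNReal.ofReal_ne_top]
              gcongr
              exact hG.lintegral_comp_le hL hKm hφU (F := fun y => ‖w n y - u y‖ₑ)
                (((hw n).continuous.aestronglyMeasurable.sub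
                  (huK hK hφU).aestronglyMeasurable).enorm)
    have hlim2 : Tendsto (fun n => ∫ x in K, lineDeriv ℝ (fun x => w n (G x)) x e * φ x) atTop
        (𝓝 (∫ x in K, pullback G g x i * φ x)) := by
      have hpm : AEStronglyMeasurable (fun x => pullback G g x i) (volume.restrict K) :=
        (EuclideanSpace.proj (𝕜 := ℝ) i).continuous.comp_aestronglyMeasurable
          (hG.aestronglyMeasurable_pullback hL hKm hφU (hgK hK hφU).aestronglyMeasurable)
      apply tendsto_integral_of_L1
      · exact hpm.mul hφ.continuous.aestronglyMeasurable
      · refine Filter.Eventually.of_forall fun n => ?_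
        obtain ⟨Ln, hLn⟩ := hwL n
        have := (hφ.continuous.integrable_of_hasCompactSupport hφc (μ := volume)).smul_of_top_right
          (hLn.memLp_lineDeriv (μ := volume) e)
        exact this.integrableOn
      · have hz : Tendsto (fun n => ENNReal.ofReal (C * H) * ENNReal.ofReal M *
            (ENNReal.ofReal ((C / H) ^ 2) * ∫⁻ y in G '' K, ‖D n y - g y‖ₑ)) atTop (𝓝 0) := by
          have := ENNReal.Tendsto.const_mul (ENNReal.Tendsto.const_mul hDg
            (Or.inr (ENNReal.ofReal_ne_top (r := (C / H) ^ 2))))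
            (Or.inr (ENNReal.mul_ne_top (ENNReal.ofReal_ne_top (r := C * H))
              (ENNReal.ofReal_ne_top (r := M))))
          simpa using this
        refine tendsto_of_tendsto_of_tendsto_of_le_of_le tendsto_const_nhds hz
          (fun _ => zero_le) fun n => ?_
        have hmeas : AEMeasurable (fun y => ‖D n y - g y‖ₑ) (volume.restrict (G '' K)) := by
          -- `D n` is known only on `G(K)`, as the Riesz representative of the continuous derivative
          -- of `w n`; measurability comes from there.
          have hDm : AEStronglyMeasurable (D n) (volume.restrict (G '' K)) := by
            have hc : Continuous fun y =>
                (InnerProductSpace.toDual ℝ Plane).symm (fderiv ℝ (w n) y) :=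
              (LinearIsometryEquiv.continuous _).comp ((hw n).continuous_fderiv (by simp))
            refine hc.aestronglyMeasurable.congr
              ((ae_restrict_iff' (hcomp hK).measurableSet).2
                (Filter.Eventually.of_forall fun y hy => ?_))
            simp only [hwD n y hy]
            exact (InnerProductSpace.toDual ℝ Plane).symm_apply_apply (D n y)
          exact (hDm.sub (hgK hK hφU).aestronglyMeasurable).enorm
        calc _ ≤ ∫⁻ x in K, ENNReal.ofReal (C * H) * ENNReal.ofReal M *
              ‖D n (G x) - g (G x)‖ₑ := by
              refine lintegral_mono_ae ?_
              filter_upwards [ae_restrict_of_ae_restrict_of_subset hφU hG.norm_fderiv_le,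
                ae_restrict_mem hKm] with x hx hxK
              have hcd : HasFDerivAt (fun x => w n (G x))
                  ((fderiv ℝ (w n) (G x)).comp (fderiv ℝ G x)) x :=
                (((hw n).differentiable (by simp)) (G x)).hasFDerivAt.comp x hx.1.hasFDerivAt
              have hpb : pullback G g x i = inner ℝ (g (G x)) (fderiv ℝ G x e) := by
                rw [← ContinuousLinearMap.adjoint_inner_left]
                simp [e, pullback, EuclideanSpace.inner_single_right]
              rw [hcd.hasLineDerivAt e |>.lineDeriv, hpb, ContinuousLinearMap.comp_apply,
                hwD n _ (mem_image_of_mem _ hxK), innerSL_apply_apply, ← sub_mul,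
                ← inner_sub_left, enorm_mul]
              have hin : ‖inner ℝ (D n (G x) - g (G x)) (fderiv ℝ G x e)‖ₑ ≤
                  ‖D n (G x) - g (G x)‖ₑ * ENNReal.ofReal (C * H) := by
                rw [← ofReal_norm, ← ofReal_norm, ← ENNReal.ofReal_mul (norm_nonneg _)]
                apply ENNReal.ofReal_le_ofReal
                refine (norm_inner_le_norm _ _).trans ?_
                gcongr
                refine ((fderiv ℝ G x).le_opNorm e).trans ?_
                simpa [e] using hx.2
              calc _ ≤ (‖D n (G x) - g (G x)‖ₑ * ENNReal.ofReal (C * H)) * ENNReal.ofReal M :=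
                    mul_le_mul' hin (hφle x)
                _ = _ := by ring
          _ ≤ _ := by
              rw [lintegral_const_mul' _ _
                (ENNReal.mul_ne_top ENNReal.ofReal_ne_top ENNReal.ofReal_ne_top)]
              gcongr
              exact hG.lintegral_comp_le hL hKm hφU hmeas
    rw [hsqK _ fun x hx => by rw [hoff' x hx, mul_zero],
      hsqK _ fun x hx => by rw [hoff x hx, mul_zero]]
    exact tendsto_nhds_unique hlim1 ((hlim2.neg).congr fun n => (hparts n).symm)

/-- The Sobolev norm on the parameter domain is bounded by the scaled Sobolev norm on the patch. -/
theorem IsGeometryMap.h1NormSq_comp_le (hG : IsGeometryMap G C H) (hC : 0 < C) (hH : 0 < H)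
    {u v : Plane → ℝ} (huv : ∀ x ∈ unitSquare, u (G x) = v x) {g : Plane → Plane}
    (h : IsWeakGradient (G '' unitSquare) u g) :
    h1NormSq unitSquare v ≤ ENNReal.ofReal (C ^ 4 + C ^ 2) *
      ((∫⁻ y in G '' unitSquare, ‖g y‖ₑ ^ 2) +
        ENNReal.ofReal (H⁻¹ ^ 2) * l2NormSq (G '' unitSquare) u) := by
  obtain ⟨G', L, hL, heq, hG'⟩ := hG.exists_lipschitzWith
  have hsq := isOpen_unitSquare.measurableSet
  rw [← heq.image_eq] at h ⊢
  have hw := hG'.isWeakGradient_pullback hL h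
  have hv : ∀ x ∈ unitSquare, u (G' x) = v x := fun x hx => by rw [heq hx, huv x hx]
  have hwv : IsWeakGradient unitSquare v (pullback G' g) := by
    refine ⟨?_, hw.2.1, fun φ hφ hφc hφU i => ?_⟩
    · exact (locallyIntegrableOn_iff isOpen_unitSquare.isLocallyClosed).2 fun K hKU hK =>
        (hw.1.integrableOn_compact_subset hKU hK).congr_fun (fun x hx => hv x (hKU hx))
          hK.measurableSet
    · rw [← hw.2.2 φ hφ hφc hφU i]
      exact setIntegral_congr_fun hsq fun x hx => by simp only [hv x hx]
  have hl2 : l2NormSq unitSquare v ≤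
      ENNReal.ofReal ((C / H) ^ 2) * l2NormSq (G' '' unitSquare) u := by
    refine le_trans (le_of_eq ?_) (hG'.lintegral_comp_le hL hsq subset_rfl
      (F := fun y => ‖u y‖ₑ ^ 2) (h.1.aestronglyMeasurable.enorm.pow_const 2))
    exact setLIntegral_congr_fun hsq fun x hx => by simp only [hv x hx]
  -- The chain rule contributes `(C H)²` and the Jacobian `(C/H)²`, so `H` cancels and `C⁴` remains.
  have hsemi : h1SeminormSq unitSquare v ≤
      ENNReal.ofReal (C ^ 4) * ∫⁻ y in G' '' unitSquare, ‖g y‖ₑ ^ 2 := by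
    refine (iInf₂_le _ hwv).trans ?_
    calc _ ≤ ∫⁻ x in unitSquare, ENNReal.ofReal (C * H) ^ 2 * ‖g (G' x)‖ₑ ^ 2 := by
          refine lintegral_mono_ae ?_
          filter_upwards [hG'.enorm_pullback_le g] with x hx
          rw [← mul_pow]
          gcongr
      _ ≤ ENNReal.ofReal (C * H) ^ 2 *
          (ENNReal.ofReal ((C / H) ^ 2) * ∫⁻ y in G' '' unitSquare, ‖g y‖ₑ ^ 2) := by
          rw [lintegral_const_mul' _ _ (by simp)]
          gcongr
          exact hG'.lintegral_comp_le hL hsq subset_rfl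
            (F := fun y => ‖g y‖ₑ ^ 2) (h.2.1.aestronglyMeasurable.enorm.pow_const 2)
      _ = _ := by
          rw [← mul_assoc, ← ENNReal.ofReal_pow (by positivity),
            ← ENNReal.ofReal_mul (by positivity)]
          congr 2
          field_simp
  have hCH : ENNReal.ofReal ((C / H) ^ 2) = ENNReal.ofReal (C ^ 2) * ENNReal.ofReal (H⁻¹ ^ 2) := by
    rw [← ENNReal.ofReal_mul (by positivity)]
    congr 1
    field_simp
  rw [h1NormSq, mul_add, add_comm]
  refine add_le_add (hsemi.trans ?_) (hl2.trans ?_)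
  · gcongr
    nlinarith [sq_nonneg C]
  · rw [hCH, mul_assoc]
    gcongr
    nlinarith [sq_nonneg (C ^ 2)]

end

/-! ### The discrete Sobolev inequality on the parameter domain -/

/-- Markov's inequality for bipolynomials. -/
theorem IsBipolynomial.abs_sub_le {p : ℕ} {F : ℝ → ℝ → ℝ} (hF : IsBipolynomial p F)
    {l r : Fin 2 → ℝ} (hlr : ∀ i, l i < r i) {M : ℝ} (hM : 0 < M)
    (h : ∀ t ∈ Icc (l 0) (r 0), ∀ u ∈ Icc (l 1) (r 1), |F t u| ≤ M)
    {X Y t u : ℝ} (hX : X ∈ Icc (l 0) (r 0)) (hY : Y ∈ Icc (l 1) (r 1))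
    (ht : t ∈ Icc (l 0) (r 0)) (hu : u ∈ Icc (l 1) (r 1)) :
    |F t u - F X Y| ≤ 4 * (p : ℝ) ^ 2 * M / (r 0 - l 0) * |t - X| +
      4 * (p : ℝ) ^ 2 * M / (r 1 - l 1) * |u - Y| := by
  obtain ⟨P, hP, hP'⟩ := hF.left u
  obtain ⟨R, hR, hR'⟩ := hF.right X
  have h1 := abs_eval_sub_eval_le hP hM (hlr 0) (fun s hs => by rw [← hP' s]; exact h s hs u hu)
    hX ht
  have h2 := abs_eval_sub_eval_le hR hM (hlr 1) (fun s hs => by rw [← hR' s]; exact h X hX s hs)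
    hY hu
  rw [← hP', ← hP'] at h1
  rw [← hR', ← hR'] at h2
  calc |F t u - F X Y| = |(F t u - F X u) + (F X u - F X Y)| := by ring_nf
    _ ≤ _ := (abs_add_le _ _).trans (add_le_add h1 h2)

/-- Every point of an interval is close to a small interval in the interior. -/
theorem exists_center {l r X s : ℝ} (hX : X ∈ Icc l r) (hs : 0 < s) (hsl : 5 * s < r - l) :
    ∃ a, ∀ t, |t - a| ≤ s → t ∈ Ioo l r ∧ |t - X| ≤ 3 * s := by
  rcases le_total X ((l + r) / 2) with h | h
  -- The centre is moved from `X` towards the midpoint by `3s/2`: the interval of radius `s` stays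
  -- `s/2` away from `X` and within `5s/2`, less than half the length.
  · refine ⟨X + 3 / 2 * s, fun t ht => ?_⟩
    rw [abs_le] at ht ⊢
    refine ⟨⟨?_, ?_⟩, ?_, ?_⟩ <;> linarith [hX.1, hX.2, ht.1, ht.2]
  · refine ⟨X - 3 / 2 * s, fun t ht => ?_⟩
    rw [abs_le] at ht ⊢
    refine ⟨⟨?_, ?_⟩, ?_, ?_⟩ <;> linarith [hX.1, hX.2, ht.1, ht.2]

/-- The Sobolev inequality with logarithmic constant for functions with a weak gradient which are
continuous and bounded from below on a small square. -/
theorem IsWeakGradient.ofReal_sq_le {v : Plane → ℝ} {g : Plane → Plane}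
    (h : IsWeakGradient unitSquare v g) {a : Fin 2 → ℝ} (ha : ∀ i, a i ∈ Ioo (0 : ℝ) 1) {s m₀ : ℝ}
    (hs : 0 < s) (hs' : s ≤ 1 / 2) (hm₀ : 0 ≤ m₀)
    (hv : ∀ y : Plane, (∀ i, |y i - a i| ≤ s) → ContinuousAt v y ∧ m₀ ≤ |v y|) :
    ENNReal.ofReal (m₀ ^ 2) ≤ ENNReal.ofReal (96 * (1 + Real.log (1 / s))) *
      (l2NormSq unitSquare v + ∫⁻ x in unitSquare, ‖g x‖ₑ ^ 2) := by
  -- Mollifications are controlled on compact subsets only, so the square is shrunk slightly around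
  -- `a`; `α ≤ 1/4` keeps its side at least `1/2`.
  obtain ⟨α, hα0, hα4, hαa⟩ : ∃ α : ℝ, 0 < α ∧ α ≤ 1 / 4 ∧ ∀ i, a i ∈ Ioo α (1 - α) := by
    have hd : 0 < min (min (a 0) (1 - a 0)) (min (a 1) (1 - a 1)) := by
      have h0 := ha 0
      have h1 := ha 1
      simp only [lt_min_iff]
      exact ⟨⟨h0.1, by linarith [h0.2]⟩, h1.1, by linarith [h1.2]⟩
    set d := min (min (a 0) (1 - a 0)) (min (a 1) (1 - a 1))
    have h0 : d ≤ a 0 := (min_le_left _ _).trans (min_le_left _ _)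
    have h0' : d ≤ 1 - a 0 := (min_le_left _ _).trans (min_le_right _ _)
    have h1 : d ≤ a 1 := (min_le_right _ _).trans (min_le_left _ _)
    have h1' : d ≤ 1 - a 1 := (min_le_right _ _).trans (min_le_right _ _)
    refine ⟨min (1 / 4) (d / 2), by positivity, min_le_left _ _, fun i => ?_⟩
    have h2 : min (1 / 4) (d / 2) ≤ d / 2 := min_le_right _ _
    fin_cases i <;> constructor <;> simp only [Fin.zero_eta, Fin.mk_one] <;> linarith
  -- The rays run to the farther vertical side, at distance between `1/4` and 1. The upper bound
  -- places the points of parameter `s` in the box around `a`.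
  obtain ⟨e, he, hea, hea'⟩ : ∃ e ∈ Icc α (1 - α), 1 / 4 ≤ |e - a 0| ∧ |e - a 0| ≤ 1 := by
    have h0 := hαa 0
    rcases le_total (a 0) (1 / 2) with hh | hh
    · refine ⟨1 - α, ⟨by linarith, le_rfl⟩, le_trans (by linarith) (le_abs_self _), ?_⟩
      rw [abs_le]
      constructor <;> linarith [h0.1, h0.2]
    · refine ⟨α, ⟨le_rfl, by linarith⟩, ?_, ?_⟩
      · rw [abs_sub_comm]
        exact le_trans (by linarith) (le_abs_self _)
      · rw [abs_le]
        constructor <;> linarith [h0.1, h0.2]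
  set K : Set Plane := {x | ∀ i, x i ∈ Icc α (1 - α)} with hKdef
  have hK : IsCompact K := by
    have hp : IsCompact (univ.pi fun _ : Fin 2 => Icc α (1 - α)) :=
      isCompact_univ_pi fun _ => isCompact_Icc
    have := hp.image (PiLp.continuous_toLp 2 fun _ : Fin 2 => ℝ)
    convert this using 1
    ext x
    constructor
    · exact fun hx => ⟨x.ofLp, fun i _ => hx i, rfl⟩
    · rintro ⟨y, hy, rfl⟩ i
      exact hy i (mem_univ i)
  have hKU : K ⊆ unitSquare := fun x hx i =>
    ⟨by linarith [(hx i).1], by linarith [(hx i).2]⟩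
  obtain ⟨w, D, hw, -, hwD, hwl2, hDl2, -, -, hlim⟩ :=
    h.exists_smooth_approx isOpen_unitSquare hK hKU
  set Q : Set Plane := {x | ∀ i, x i ∈ Ioo α (1 - α)}
  have hQK : Q ⊆ K := fun x hx i => Ioo_subset_Icc_self (hx i)
  set z : ℝ → Plane := fun m => !₂[a 0 + s * (e - a 0), a 1 + s * (m - a 1)] with hz
  have hzc : Continuous z := by fun_prop
  have hzK : ∀ m ∈ Ioo α (1 - α), z m ∈ K ∧ ∀ i, |z m i - a i| ≤ s := by
    intro m hm
    have h0 := hαa 0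
    have h1 := hαa 1
    constructor
    · intro i
      fin_cases i <;> simp [hz] <;> constructor <;>
        nlinarith [h0.1, h0.2, h1.1, h1.2, hm.1, hm.2, he.1, he.2]
    · intro i
      fin_cases i
      · simp [hz, abs_mul, abs_of_pos hs]
        nlinarith
      · simp [hz, abs_mul, abs_of_pos hs]
        have : |m - a 1| ≤ 1 := by
          rw [abs_le]
          constructor <;> linarith [h1.1, h1.2, hm.1, hm.2]
        nlinarith
  set B := ENNReal.ofReal (48 * (1 + Real.log (1 / s))) *
    (l2NormSq unitSquare v + ∫⁻ x in unitSquare, ‖g x‖ₑ ^ 2)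
  have hB : ∀ n, ∫⁻ m in Ioo α (1 - α), ‖w n (z m)‖ₑ ^ 2 ≤ B := fun n => by
    refine (lintegral_segment_le ((hw n).of_le (by simp)) (by linarith) (hαa 0) (hαa 1) he hea hs
      hs').trans (mul_le_mul_right (add_le_add ?_ ?_) _)
    · exact (lintegral_mono_set hQK).trans (hwl2 n)
    · refine (lintegral_mono_set hQK).trans (le_trans (le_of_eq ?_) (hDl2 n))
      refine setLIntegral_congr_fun hK.measurableSet fun x hx => ?_
      simp only [hwD n x hx]
      rw [← ofReal_norm, innerSL_apply_norm, ofReal_norm]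
  -- Continuity of `v` on the box gives pointwise convergence on the segment, where convergence in
  -- `L¹` of the plane would say nothing.
  have hfatou : ∫⁻ m in Ioo α (1 - α), ‖v (z m)‖ₑ ^ 2 ≤ B := by
    calc _ = ∫⁻ m in Ioo α (1 - α), Filter.liminf (fun n => ‖w n (z m)‖ₑ ^ 2) atTop := by
          refine setLIntegral_congr_fun measurableSet_Ioo fun m hm => ?_
          have hm' := hzK m hm
          have := (hlim (z m) hm'.1 (hv _ hm'.2).1).enorm
          exact (((ENNReal.continuous_pow 2).tendsto _).comp this).liminf_eq.symm
      _ ≤ Filter.liminf (fun n => ∫⁻ m in Ioo α (1 - α), ‖w n (z m)‖ₑ ^ 2) atTop := by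
          refine lintegral_liminf_le fun n => ?_
          exact (((hw n).continuous.comp hzc).enorm.measurable).pow_const 2
      _ ≤ B := Filter.liminf_le_of_frequently_le'
          (Filter.Eventually.frequently (Filter.Eventually.of_forall hB))
  have hlow : ENNReal.ofReal (m₀ ^ 2) * ENNReal.ofReal (1 / 2) ≤ B := by
    calc _ ≤ ENNReal.ofReal (m₀ ^ 2) * volume (Ioo α (1 - α)) := by
          rw [Real.volume_Ioo]
          gcongr
          linarith
      _ = ∫⁻ m in Ioo α (1 - α), ENNReal.ofReal (m₀ ^ 2) := (setLIntegral_const _ _).symm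
      _ ≤ ∫⁻ m in Ioo α (1 - α), ‖v (z m)‖ₑ ^ 2 := by
          refine setLIntegral_mono' measurableSet_Ioo fun m hm => ?_
          rw [← ofReal_norm, ← ENNReal.ofReal_pow (norm_nonneg _)]
          apply ENNReal.ofReal_le_ofReal
          have := (hv _ (hzK m hm).2).2
          rw [Real.norm_eq_abs]
          gcongr
      _ ≤ B := hfatou
  calc ENNReal.ofReal (m₀ ^ 2)
      = ENNReal.ofReal 2 * (ENNReal.ofReal (m₀ ^ 2) * ENNReal.ofReal (1 / 2)) := by
        rw [← ENNReal.ofReal_mul (sq_nonneg _), ← ENNReal.ofReal_mul zero_le_two]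
        congr 1
        ring
    _ ≤ ENNReal.ofReal 2 * B := by gcongr
    _ = _ := by
        rw [← mul_assoc, ← ENNReal.ofReal_mul zero_le_two]
        congr 2
        ring

/-- The discrete Sobolev inequality for tensor-product splines with a weak gradient. -/
theorem enorm_sq_le_of_isWeakGradient {p : ℕ} {Ξ₁ Ξ₂ : OpenKnotVector p} {C h : ℝ} (hp : 1 ≤ p)
    (hC : 0 < C) (hh : 0 < h) (h₁ : QuasiUniform Ξ₁ C h) (h₂ : QuasiUniform Ξ₂ C h)
    {v : Plane → ℝ} (hv : v ∈ tensorSplineSpace Ξ₁ Ξ₂) {g : Plane → Plane}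
    (hg : IsWeakGradient unitSquare v g) {x : Plane} (hx : ∀ i, x i ∈ Icc (0 : ℝ) 1) :
    ‖v x‖ₑ ^ 2 ≤ ENNReal.ofReal (384 * (1 + Real.log (48 * (p : ℝ) ^ 2 / (C * h)))) *
      (l2NormSq unitSquare v + ∫⁻ x in unitSquare, ‖g x‖ₑ ^ 2) := by
  obtain ⟨l, r, F, hF, hlr, hvx, hvF⟩ := exists_cell h₁ h₂ hv hx
  have hp' : (1 : ℝ) ≤ (p : ℝ) ^ 2 := one_le_pow₀ (by exact_mod_cast hp)
  have hCh : 0 < C * h := mul_pos hC hh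
  have hCh1 : C * h ≤ 1 := by
    have := hlr 0
    linarith [this.1, this.2.1, this.2.2.2.1]
  -- With distance at most `3s` in each variable, each of the two Markov terms is at most `12 p² M s
  -- / (C h) = M/4`, so half of `M` survives.
  set s : ℝ := C * h / (48 * (p : ℝ) ^ 2) with hsdef
  have hs : 0 < s := by positivity
  have hs48 : s ≤ C * h / 48 := by
    rw [hsdef]
    gcongr
    linarith
  obtain ⟨⟨X, Y⟩, ⟨hX, hY⟩, hmax⟩ := (isCompact_Icc.prod isCompact_Icc).exists_isMaxOn
    (s := Icc (l 0) (r 0) ×ˢ Icc (l 1) (r 1)) ⟨(x 0, x 1), (hlr 0).2.2.2.2, (hlr 1).2.2.2.2⟩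
    (f := fun q : ℝ × ℝ => |F q.1 q.2|) hF.continuous.abs.continuousOn
  set M := |F X Y|
  have hMle : ∀ t ∈ Icc (l 0) (r 0), ∀ u ∈ Icc (l 1) (r 1), |F t u| ≤ M := fun t ht u hu =>
    hmax (show (t, u) ∈ Icc (l 0) (r 0) ×ˢ Icc (l 1) (r 1) from ⟨ht, hu⟩)
  have hvM : |v x| ≤ M := by rw [hvx]; exact hMle _ (hlr 0).2.2.2.2 _ (hlr 1).2.2.2.2
  rcases (abs_nonneg (F X Y)).eq_or_lt with hM0 | hM
  · have : v x = 0 := by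
      rw [← abs_nonpos_iff]; exact hvM.trans hM0.symm.le
    simp [this]
  have hc : ∀ i, 5 * s < r i - l i := fun i => by linarith [(hlr i).2.2.2.1]
  obtain ⟨a₀, ha₀⟩ := exists_center hX hs (hc 0)
  obtain ⟨a₁, ha₁⟩ := exists_center hY hs (hc 1)
  have hbox : ∀ y : Plane, (∀ i, |y i - ![a₀, a₁] i| ≤ s) → ContinuousAt v y ∧ M / 2 ≤ |v y| := by
    intro y hy
    have hy0 := ha₀ (y 0) (hy 0)
    have hy1 := ha₁ (y 1) (hy 1)
    have hmem : ∀ i, y i ∈ Ioo (l i) (r i) := by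
      intro i; fin_cases i
      · exact hy0.1
      · exact hy1.1
    constructor
    · have hopen : IsOpen {y : Plane | ∀ i, y i ∈ Ioo (l i) (r i)} := by
        have : {y : Plane | ∀ i, y i ∈ Ioo (l i) (r i)} =
            ⋂ i, (fun y : Plane => y i) ⁻¹' Ioo (l i) (r i) := by ext; simp
        rw [this]
        exact isOpen_iInter_of_finite fun i => isOpen_Ioo.preimage (by fun_prop)
      have hFc : Continuous fun y : Plane => F (y 0) (y 1) := by
        have h2 : Continuous fun y : Plane => ((y 0, y 1) : ℝ × ℝ) := by fun_prop
        exact hF.continuous.comp h2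
      refine hFc.continuousAt.congr ?_
      filter_upwards [hopen.mem_nhds hmem] with q hq using (hvF q hq).symm
    · rw [hvF y hmem]
      have h3 := hF.abs_sub_le (fun i => (hlr i).2.2.1) hM hMle hX hY
        (Ioo_subset_Icc_self hy0.1) (Ioo_subset_Icc_self hy1.1)
      have h4 : ∀ i : Fin 2, ∀ d : ℝ, d ≤ 3 * s →
          4 * (p : ℝ) ^ 2 * M / (r i - l i) * d ≤ M / 4 := fun i d hd => by
        have hle := (hlr i).2.2.2.1
        calc 4 * (p : ℝ) ^ 2 * M / (r i - l i) * d
            ≤ 4 * (p : ℝ) ^ 2 * M / (r i - l i) * (3 * s) := by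
              have := (hlr i).2.2.1
              have : 0 < r i - l i := by linarith
              gcongr
          _ ≤ 4 * (p : ℝ) ^ 2 * M / (C * h) * (3 * s) := by gcongr
          _ = M / 4 := by
              rw [hsdef]
              field_simp
              ring
      have h5 := h4 0 _ hy0.2
      have h6 := h4 1 _ hy1.2
      have h7 : M ≤ |F (y 0) (y 1)| + |F (y 0) (y 1) - F X Y| := by
        have := abs_sub_abs_le_abs_sub (F X Y) (F (y 0) (y 1))
        rw [abs_sub_comm] at this
        linarith
      linarith
  have ha : ∀ i, ![a₀, a₁] i ∈ Ioo (0 : ℝ) 1 := by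
    intro i
    have h0 := hlr 0
    have h1 := hlr 1
    fin_cases i
    · have := (ha₀ a₀ (by simpa using hs.le)).1
      exact ⟨lt_of_le_of_lt h0.1 this.1, lt_of_lt_of_le this.2 h0.2.1⟩
    · have := (ha₁ a₁ (by simpa using hs.le)).1
      exact ⟨lt_of_le_of_lt h1.1 this.1, lt_of_lt_of_le this.2 h1.2.1⟩
  have key := hg.ofReal_sq_le ha hs (by linarith) (by positivity) hbox
  have h1s : 1 / s = 48 * (p : ℝ) ^ 2 / (C * h) := by rw [hsdef, one_div_div]
  rw [h1s] at key
  calc ‖v x‖ₑ ^ 2 ≤ ENNReal.ofReal 4 * ENNReal.ofReal ((M / 2) ^ 2) := by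
        rw [← ofReal_norm, ← ENNReal.ofReal_pow (norm_nonneg _), ← ENNReal.ofReal_mul (by norm_num)]
        apply ENNReal.ofReal_le_ofReal
        rw [Real.norm_eq_abs]
        calc |v x| ^ 2 ≤ M ^ 2 := by gcongr
          _ = 4 * (M / 2) ^ 2 := by ring
    _ ≤ ENNReal.ofReal 4 * _ := mul_le_mul_right key _
    _ = _ := by
        rw [← mul_assoc, ← ENNReal.ofReal_mul (by norm_num)]
        congr 2
        ring

/-! ### Constants and assembly -/

theorem closure_unitSquare_subset {x : Plane} (hx : x ∈ closure unitSquare) (i : Fin 2) :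
    x i ∈ Icc (0 : ℝ) 1 := by
  have hcl : IsClosed ((fun x : Plane => x i) ⁻¹' Icc (0 : ℝ) 1) :=
    isClosed_Icc.preimage (by fun_prop)
  have hsub : unitSquare ⊆ (fun x : Plane => x i) ⁻¹' Icc (0 : ℝ) 1 :=
    fun y hy => Ioo_subset_Icc_self (hy i)
  exact closure_minimal hsub hcl hx

theorem one_le_logFactor {p : ℕ} {H h hhat : ℝ} (hhat0 : 0 < hhat) (hhat1 : hhat ≤ 1)
    (hH : 0 < H) (hh : h = hhat * H) : 1 ≤ logFactor p H h := by
  have : 1 ≤ H / h := by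
    rw [hh, le_div_iff₀ (by positivity)]
    nlinarith
  have h1 := Real.log_nonneg this
  have h2 := Real.log_natCast_nonneg p
  rw [logFactor]
  linarith

/-- To bound by the Sobolev seminorm it suffices to bound by the norms of all weak gradients. -/
theorem le_mul_add_h1SeminormSq {U : Set Plane} {u : Plane → ℝ} {a b c : ℝ≥0∞} (hc : c ≠ 0)
    (hc' : c ≠ ⊤) (h : ∀ g, IsWeakGradient U u g → a ≤ c * (b + ∫⁻ x in U, ‖g x‖ₑ ^ 2)) :
    a ≤ c * (b + h1SeminormSq U u) := by
  -- Dividing by `c`, neither 0 nor `⊤`, exposes the infimum. An empty family has infimum `⊤`, so a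
  -- missing weak gradient needs no separate case.
  rw [mul_comm, ← ENNReal.div_le_iff hc hc', h1SeminormSq, ENNReal.add_iInf]
  refine le_iInf fun g => ?_
  rw [ENNReal.add_iInf]
  refine le_iInf fun hg => ?_
  rw [ENNReal.div_le_iff hc hc', mul_comm]
  exact h g hg

/-- The logarithm in the discrete Sobolev inequality is bounded by the logarithmic factor. -/
theorem one_add_log_le {p : ℕ} {C H h hhat : ℝ} (hp : 1 ≤ p) (hC : 0 < C) (hhat0 : 0 < hhat)
    (hhat1 : hhat ≤ 1) (hH : 0 < H) (hh : h = hhat * H) :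
    1 + Real.log (48 * (p : ℝ) ^ 2 / (C * hhat)) ≤
      (2 + Real.log 48 + |Real.log C|) * logFactor p H h := by
  have hp0 : (0 : ℝ) < p := by exact_mod_cast hp
  have hHh : H / h = hhat⁻¹ := by rw [hh]; field_simp
  have hΛ := one_le_logFactor (p := p) hhat0 hhat1 hH hh
  have h48 : 0 ≤ Real.log 48 := Real.log_nonneg (by norm_num)
  have hlp := Real.log_natCast_nonneg p
  have hlh : Real.log hhat ≤ 0 := Real.log_nonpos hhat0.le hhat1
  have hlC := neg_abs_le (Real.log C)
  rw [Real.log_div (by positivity) (by positivity), Real.log_mul (by norm_num) (by positivity),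
    Real.log_pow, Real.log_mul hC.ne' hhat0.ne']
  rw [logFactor, hHh, Real.log_inv] at hΛ ⊢
  push_cast
  nlinarith [mul_nonneg (add_nonneg h48 (abs_nonneg (Real.log C))) (sub_nonneg.2 hΛ)]

end SplinePatch

open SplinePatch in
theorem mainTheorem3 (C₁ C₃ : ℝ) (hC₁ : 0 < C₁) (hC₃ : 0 < C₃) :
    ∃ c : ℝ, 0 < c ∧
      ∀ (p : ℕ) (Ξ₁ Ξ₂ : OpenKnotVector p) (hhat H h : ℝ) (Γ : Set Plane) (G : Plane → Plane),
        1 ≤ p → 0 < hhat → hhat ≤ 1 → 0 < H → h = hhat * H →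
        QuasiUniform Ξ₁ C₃ hhat → QuasiUniform Ξ₂ C₃ hhat →
        Γ ⊆ frontier unitSquare → IsGeometryMap G C₁ H →
        (∀ v ∈ parameterSpace Ξ₁ Ξ₂ Γ,
          supSq (closure unitSquare) v ≤
            ENNReal.ofReal (c * logFactor p H h) * h1NormSq unitSquare v) ∧
        (∀ u ∈ physicalSpace Ξ₁ Ξ₂ Γ G,
          supSq (G '' unitSquare) u ≤
            ENNReal.ofReal (c * logFactor p H h) *
              (h1SeminormSq (G '' unitSquare) u +
                ENNReal.ofReal (H⁻¹ ^ 2) * l2NormSq (G '' unitSquare) u) ∧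
          (ContinuousOn u (closure (G '' unitSquare)) →
            supSq (closure (G '' unitSquare)) u ≤
              ENNReal.ofReal (c * logFactor p H h) *
                (h1SeminormSq (G '' unitSquare) u +
                  ENNReal.ofReal (H⁻¹ ^ 2) * l2NormSq (G '' unitSquare) u))) := by
  have h48 : 0 ≤ Real.log 48 := Real.log_nonneg (by norm_num)
  set c₀ : ℝ := 384 * (2 + Real.log 48 + |Real.log C₃|) with hc₀
  have hc₀pos : 0 < c₀ := by positivity
  -- One constant serves both estimates: the factor dominates 1 on the parameter domain and `C₁⁴ +
  -- C₁²` from the pull-back on the patch.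
  refine ⟨c₀ * (1 + (C₁ ^ 4 + C₁ ^ 2)), by positivity, ?_⟩
  intro p Ξ₁ Ξ₂ hhat H h Γ G hp hhat0 hhat1 hH hh h₁ h₂ _ hG
  set Λ := logFactor p H h
  have hΛ : 1 ≤ Λ := one_le_logFactor hhat0 hhat1 hH hh
  have base : ∀ v ∈ parameterSpace Ξ₁ Ξ₂ Γ, ∀ x ∈ closure unitSquare,
      ‖v x‖ₑ ^ 2 ≤ ENNReal.ofReal (c₀ * Λ) * h1NormSq unitSquare v := by
    intro v hv x hx
    refine le_mul_add_h1SeminormSq (ENNReal.ofReal_pos.2 (by positivity)).ne'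
      ENNReal.ofReal_ne_top fun g hg => ?_
    refine (enorm_sq_le_of_isWeakGradient hp hC₃ hhat0 h₁ h₂ hv.1 hg
      (closure_unitSquare_subset hx)).trans ?_
    refine mul_le_mul_left (ENNReal.ofReal_le_ofReal ?_) _
    rw [hc₀, mul_assoc]
    exact mul_le_mul_of_nonneg_left (one_add_log_le hp hC₃ hhat0 hhat1 hH hh) (by norm_num)
  have phys : ∀ u ∈ physicalSpace Ξ₁ Ξ₂ Γ G, ∀ y ∈ G '' unitSquare,
      ‖u y‖ₑ ^ 2 ≤ ENNReal.ofReal (c₀ * (1 + (C₁ ^ 4 + C₁ ^ 2)) * Λ) *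
        (h1SeminormSq (G '' unitSquare) u +
          ENNReal.ofReal (H⁻¹ ^ 2) * l2NormSq (G '' unitSquare) u) := by
    rintro u ⟨v, hv, huv⟩ _ ⟨x, hx, rfl⟩
    rw [huv x hx, add_comm (h1SeminormSq _ _)]
    refine le_mul_add_h1SeminormSq (ENNReal.ofReal_pos.2 (by positivity)).ne'
      ENNReal.ofReal_ne_top fun g hg => ?_
    refine (base v hv x (subset_closure hx)).trans
      ((mul_le_mul_right (hG.h1NormSq_comp_le hC₁ hH huv hg) _).trans ?_)
    rw [← mul_assoc, ← ENNReal.ofReal_mul (by positivity), add_comm (∫⁻ y in _, _)]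
    refine mul_le_mul_left (ENNReal.ofReal_le_ofReal ?_) _
    nlinarith [mul_pos hc₀pos (zero_lt_one.trans_le hΛ)]
  refine ⟨fun v hv => iSup₂_le fun x hx => (base v hv x hx).trans ?_, fun u hu =>
    ⟨iSup₂_le (phys u hu), fun hcont => iSup₂_le fun y hy => ?_⟩⟩
  · gcongr
    exact le_mul_of_one_le_right hc₀pos.le (by linarith [pow_pos hC₁ 4, pow_pos hC₁ 2])
  -- On the closure the bound is the limit of the bounds at points of the patch.
  · have hc : ContinuousWithinAt (fun z => ‖u z‖ₑ ^ 2) (G '' unitSquare) y :=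
      (ENNReal.continuous_pow 2).continuousAt.comp_continuousWithinAt
        (continuous_enorm.continuousAt.comp_continuousWithinAt
          ((hcont y hy).mono subset_closure))
    have : (nhdsWithin y (G '' unitSquare)).NeBot := mem_closure_iff_nhdsWithin_neBot.1 hy
    exact le_of_tendsto hc (Filter.eventually_of_mem self_mem_nhdsWithin (phys u hu))
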